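/- **Notation.** A symbol is represented by a function $a:\tfrac12\mathbb Z\times\mathbb T\to\mathbb C$, $(x,z)\mapsto a_x(z)$; write $(a_x)_k=\frac1{2\pi}\int_{-\pi}^{\pi}a_x(e^{ip})e^{-ikp}\,dp$, and, for integer $j$, $(a_j)_0$ for the zeroth Fourier coefficient of $a_j$. $V$ is the set of all $a$ for which there is $\rho\in(0,1)$ such that every $a_x$ extends analytically to $\rho<|z|<\rho^{-1}$, with a bound there that is uniform in $x$. The star-Laurent operator $L(a)$ on $\ell^2(\mathbb Z)$ has the matrix elements $L_{j,k}(a)=(a_{(j+k)/2})_{j-k}$; two functions with the same $L$ are the same symbol. The star-Toeplitz operator $T(a)$ and the star-Hankel operator $H(a)$ on $\ell^2(\mathbb N)$, $\mathbb N=\{1,2,\dots\}$, have the elements $T_{j,k}(a)=L_{j,k}(a)$ and $H_{j,k}(a)=(a_{(j-k+1)/2})_{j+k-1}$, and $T_n(a)=(L_{j,k}(a))_{1\le j,k\le n}$. The Moyal star product is $(a\star b)_x(z)=\sum_{m\in\mathbb Z}\sum_{n\in\mathbb Z}z^{m+n}(a_{x+m/2})_n(b_{x-n/2})_m$; $a^{-1_\star}\in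 V$ denotes the star inverse ($a\star a^{-1_\star}=a^{-1_\star}\star a=1$ as symbols); $(a^{\sim})_x(z)=a_{1-x}(z^{-1})$; $z^{k}$ is the symbol $(x,z)\mapsto z^k$. A $+$ (respectively $-$) symbol is one for which $L(a)$ is lower (respectively upper) triangular. A star logarithm $\log_\star a$ is a symbol with $L(\log_\star a)=\frac1{2\pi i}\oint_C\log\zeta\,(\zeta-L(a))^{-1}d\zeta$, where $C$ is a closed simple curve traversed anticlockwise and strictly surrounding the spectrum of $L(a)$, and $\log$ is an analytic branch of the logarithm on an open set containing $C$ and its interior. A symbol $a\in V$ has zero star winding number if it has a Wiener–Hopf star factorization $a=a_+^L\star a_-^L=a_-^R\star a_+^R$ with $\pm$ symbols $a_\pm^{L/R}\in V$ whose star logarithms exist and belong to $V$. **Proposition.** Let $a\in V$ have zero star winding number, with any Wiener–Hopf star factorization $a=a_+^L\star a_-^L=a_-^R\star a_+^R$. Then $a_+^R$ and $a_-^R$ are star invertible in $V$, and the operator $$T\bigl(a_-^L\star(a_+^R)^{-1_\star}\bigr)\,T\bigl((a_-^R)^{-1_\star}\star a_+^L\bigr)$$ is invertible, differs from the identity by a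 trace class operator, and has nonzero Fredholm determinant. For every integer $n\ge 0$ the operator $H\bigl(z^{-n}\star a_-^L\star(a_+^R)^{-1_\star}\bigr)H\bigl(((a_-^R)^{-1_\star}\star a_+^L)^{\sim}\star z^{-n}\bigr)$ is trace class, the numbers $(a^L_{+,j})_0(a^L_{-,j})_0$, $1\le j\le n$, are nonzero, and $$\det T_n(a)=\frac{\det\Bigl(I-H\bigl(z^{-n}\star a_-^L\star(a_+^R)^{-1_\star}\bigr)H\bigl(((a_-^R)^{-1_\star}\star a_+^L)^{\sim}\star z^{-n}\bigr)\Bigr)}{\det\Bigl(T\bigl(a_-^L\star(a_+^R)^{-1_\star}\bigr)T\bigl((a_-^R)^{-1_\star}\star a_+^L\bigr)\Bigr)}\exp\Bigl(\sum_{j=1}^n\log\bigl((a^L_{+,j})_0(a^L_{-,j})_0\bigr)\Bigr),$$ where the determinants on the right are Fredholm determinants. -/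

import Mathlib

namespace StarToeplitz

noncomputable section

/-! ## Symbols on half-integers times the unit circle -/

/-- A function `(x, z) ↦ a_x(z)` on `½ℤ × 𝕋`. The half-integer `x` is encoded by the integer
`N = 2 x`, that is, `a N` stands for the function `a_{N/2}` on the unit circle. -/
abbrev SymbolFn : Type := ℤ → Circle → ℂ

/-- The Fourier coefficient `(g)_k = (2π)⁻¹ ∫_{-π}^{π} g(e^{ip}) e^{-ikp} dp`. -/
def coeff (g : Circle → ℂ) (k : ℤ) : ℂ :=
  (1 / (2 * (Real.pi : ℂ))) *
    ∫ p in (-Real.pi)..Real.pi, g (Circle.exp p) * Complex.exp (-(Complex.I * (k : ℂ) * (p : ℂ)))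

/-- The open annulus `ρ < |z| < ρ⁻¹`. -/
def annulus (ρ : ℝ) : Set ℂ := {z | ρ < ‖z‖ ∧ ‖z‖ < ρ⁻¹}

/-- The class `V_ρ`: every `a_x` extends analytically to the annulus `ρ < |z| < ρ⁻¹`, and the
extensions are bounded there uniformly in `x`. -/
def MemVρ (ρ : ℝ) (a : SymbolFn) : Prop :=
  ∃ F : ℤ → ℂ → ℂ,
    (∀ N, DifferentiableOn ℂ (F N) (annulus ρ)) ∧
    (∀ N (z : Circle), F N (z : ℂ) = a N z) ∧
    ∃ M : ℝ, ∀ N, ∀ z ∈ annulus ρ, ‖F N z‖ ≤ M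

/-- The class `V`, the union of the `V_ρ` over `ρ ∈ (0, 1)`. -/
def MemV (a : SymbolFn) : Prop := ∃ ρ : ℝ, 0 < ρ ∧ ρ < 1 ∧ MemVρ ρ a

/-- Matrix elements of the star-Laurent operator: `L_{j,k}(a) = (a_{(j+k)/2})_{j-k}`. -/
def laurentEntry (a : SymbolFn) (j k : ℤ) : ℂ := coeff (a (j + k)) (j - k)

/-- Two functions represent the same symbol when they generate the same star-Laurent matrix. -/
def SameSymbol (a b : SymbolFn) : Prop := ∀ j k : ℤ, laurentEntry a j k = laurentEntry b j k

/-- The Moyal star product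
`(a ⋆ b)_x(z) = ∑_m ∑_n z^{m+n} (a_{x+m/2})_n (b_{x-n/2})_m`. -/
def starMul (a b : SymbolFn) : SymbolFn := fun N z =>
  ∑' m : ℤ, ∑' n : ℤ, (z : ℂ) ^ (m + n) * (coeff (a (N + m)) n * coeff (b (N - n)) m)

/-- The constant symbol `1`. -/
def oneSymbol : SymbolFn := fun _ _ => 1

/-- The symbol `(x, z) ↦ z ^ k`, for `k ∈ ℤ`. -/
def zpowSymbol (k : ℤ) : SymbolFn := fun _ z => (z : ℂ) ^ k

/-- The reflected symbol `(a^∼)_x(z) = a_{1-x}(z⁻¹)`. -/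
def reflect (a : SymbolFn) : SymbolFn := fun N z => a (2 - N) z⁻¹

/-- `c` is a star inverse (in `V`) of `a`: `a ⋆ c = c ⋆ a = 1` as symbols. -/
def IsStarInverse (a c : SymbolFn) : Prop :=
  MemV c ∧ SameSymbol (starMul a c) oneSymbol ∧ SameSymbol (starMul c a) oneSymbol

/-- `a` is star invertible (in `V`). -/
def StarInvertible (a : SymbolFn) : Prop := ∃ c, IsStarInverse a c

open Classical in
/-- A representative of the star inverse of `a` (and `0` if `a` is not star invertible). -/
def starInv (a : SymbolFn) : SymbolFn :=
  if h : StarInvertible a then h.choose else fun _ _ => 0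

/-- `+` symbols: the star-Laurent matrix is lower triangular. -/
def IsPlus (a : SymbolFn) : Prop := ∀ j k : ℤ, j < k → laurentEntry a j k = 0

/-- `-` symbols: the star-Laurent matrix is upper triangular. -/
def IsMinus (a : SymbolFn) : Prop := ∀ j k : ℤ, k < j → laurentEntry a j k = 0

/-! ## Operators on `ℓ²` -/

/-- The Hilbert space `ℓ²(ι)`. -/
abbrev ell2 (ι : Type) : Type := lp (fun _ : ι => ℂ) 2

/-- The matrix element `A_{i,j} = ⟨e_i, A e_j⟩` in the standard basis of `ℓ²(ι)`. -/
def entry {ι : Type} [DecidableEq ι] (A : ell2 ι →L[ℂ] ell2 ι) (i j : ι) : ℂ :=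
  (A (lp.single 2 j (1 : ℂ))) i

open Classical in
/-- The bounded operator on `ℓ²(ι)` represented by the matrix `M`. It is unique if it exists;
the value is `0` if `M` does not represent a bounded operator. -/
def matrixOp {ι : Type} [DecidableEq ι] (M : ι → ι → ℂ) : ell2 ι →L[ℂ] ell2 ι :=
  if h : ∃ A : ell2 ι →L[ℂ] ell2 ι, ∀ i j, entry A i j = M i j then h.choose else 0

/-- The star-Laurent operator `L(a)` on `ℓ²(ℤ)`. -/
def laurentOp (a : SymbolFn) : ell2 ℤ →L[ℂ] ell2 ℤ := matrixOp (laurentEntry a)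

/-- The star-Toeplitz operator `T(a)`, with elements `L_{j,k}(a)`, `j, k = 1, 2, 3, …`; the
index `i : ℕ` of Lean stands for `i + 1`. -/
def toeplitzOp (a : SymbolFn) : ell2 ℕ →L[ℂ] ell2 ℕ :=
  matrixOp fun j k => laurentEntry a ((j : ℤ) + 1) ((k : ℤ) + 1)

/-- Elements `H_{j,k}(a) = (a_{(j-k+1)/2})_{j+k-1}` of the star-Hankel operator. -/
def hankelEntry (a : SymbolFn) (j k : ℤ) : ℂ := coeff (a (j - k + 1)) (j + k - 1)

/-- The star-Hankel operator `H(a)`, with elements `H_{j,k}(a)`, `j, k = 1, 2, 3, …`. -/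
def hankelOp (a : SymbolFn) : ell2 ℕ →L[ℂ] ell2 ℕ :=
  matrixOp fun j k => hankelEntry a ((j : ℤ) + 1) ((k : ℤ) + 1)

/-- The `n × n` star-Toeplitz matrix `T_n(a)`, with elements `L_{j,k}(a)`, `1 ≤ j, k ≤ n`. -/
def toeplitzMatrix (n : ℕ) (a : SymbolFn) : Matrix (Fin n) (Fin n) ℂ :=
  Matrix.of fun j k => laurentEntry a (((j : ℕ) : ℤ) + 1) (((k : ℕ) : ℤ) + 1)

/-! ## Trace class operators and the Fredholm determinant -/

/-- Trace class (nuclear) operators: `A x = ∑_n ⟨v_n, x⟩ u_n` with `∑_n ‖u_n‖ ‖v_n‖ < ∞`. -/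
def IsTraceClass {ι : Type} (A : ell2 ι →L[ℂ] ell2 ι) : Prop :=
  ∃ u v : ℕ → ell2 ι, (Summable fun n => ‖u n‖ * ‖v n‖) ∧
    ∀ x, HasSum (fun n => inner ℂ (v n) x • u n) (A x)

/-- The Fredholm determinant of an operator `A = I + K` with `K` trace class,
`det (I + K) = ∑_{m ≥ 0} tr (Λ^m K)`, written in the standard basis as the (absolutely
convergent) sum of all the finite principal minors of `K = A - I`. -/
def fredholmDet (A : ell2 ℕ →L[ℂ] ell2 ℕ) : ℂ :=
  ∑' S : Finset ℕ, (Matrix.of fun i j : S => entry (A - 1) (i : ℕ) (j : ℕ)).det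

/-! ## Star functions and the star logarithm -/

/-- `γ`, restricted to `[0, 1]`, is a closed simple curve, of class `C¹` with bounded derivative
off finitely many parameters. -/
structure IsSimpleClosedCurve (γ : ℝ → ℂ) : Prop where
  continuousOn : ContinuousOn γ (Set.Icc 0 1)
  closed : γ 0 = γ 1
  injOn : Set.InjOn γ (Set.Ico 0 1)
  piecewise : ∃ s : Finset ℝ,
    (∀ t ∈ Set.Ioo (0 : ℝ) 1 \ (s : Set ℝ), DifferentiableAt ℝ γ t) ∧
    ContinuousOn (deriv γ) (Set.Ioo (0 : ℝ) 1 \ (s : Set ℝ)) ∧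
    ∃ C : ℝ, ∀ t ∈ Set.Ioo (0 : ℝ) 1 \ (s : Set ℝ), ‖deriv γ t‖ ≤ C

/-- The contour integral `∮_γ g(ζ) dζ`. -/
def contourIntegral {E : Type} [NormedAddCommGroup E] [NormedSpace ℂ E]
    (γ : ℝ → ℂ) (g : ℂ → E) : E :=
  ∫ t in (0 : ℝ)..1, deriv γ t • g (γ t)

/-- The image of the curve `γ`. -/
def curveImage (γ : ℝ → ℂ) : Set ℂ := γ '' Set.Icc 0 1

/-- The winding number of the curve `γ` around the point `w`. -/
def windingNumber (γ : ℝ → ℂ) (w : ℂ) : ℂ :=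
  (2 * (Real.pi : ℂ) * Complex.I)⁻¹ * contourIntegral γ fun ζ => (ζ - w)⁻¹

/-- `γ` is a closed simple curve which is traversed anticlockwise and strictly surrounds `K`. -/
structure StrictlySurrounds (γ : ℝ → ℂ) (K : Set ℂ) : Prop where
  simpleClosed : IsSimpleClosedCurve γ
  disjoint : Disjoint (curveImage γ) K
  winding : ∀ w ∈ K, windingNumber γ w = 1

/-- `b = f_⋆(a)`, where `f` is analytic in the open set `U`: for a closed simple curve `γ`
strictly surrounding the spectrum of `L(a)` and contained in `U` with its interior,
`L(b) = (2πi)⁻¹ ∮_γ f(ζ) (ζ - L(a))⁻¹ dζ`. -/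
def IsStarFunction (U : Set ℂ) (f : ℂ → ℂ) (a b : SymbolFn) : Prop :=
  IsOpen U ∧ DifferentiableOn ℂ f U ∧
    ∃ γ : ℝ → ℂ, StrictlySurrounds γ (spectrum ℂ (laurentOp a)) ∧
      curveImage γ ⊆ U ∧ (∀ w, w ∉ curveImage γ → windingNumber γ w ≠ 0 → w ∈ U) ∧
      laurentOp b = (2 * (Real.pi : ℂ) * Complex.I)⁻¹ •
        contourIntegral γ fun ζ => f ζ • resolvent (laurentOp a) ζ

/-- `b` is a star logarithm of `a`: the star function of `a` for an analytic branch `f` of the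
logarithm. -/
def IsStarLog (a b : SymbolFn) : Prop :=
  ∃ (U : Set ℂ) (f : ℂ → ℂ), (∀ z ∈ U, Complex.exp (f z) = z) ∧ IsStarFunction U f a b

/-- The star logarithm of `a` exists and belongs to `V`. -/
def HasStarLogInV (a : SymbolFn) : Prop := ∃ b, MemV b ∧ IsStarLog a b

/-! ## Wiener-Hopf star factorization -/

/-- Wiener-Hopf star factorization `a = a_+^L ⋆ a_-^L = a_-^R ⋆ a_+^R` of a symbol with zero star
winding number: the factors are `±` symbols in `V` whose star logarithms exist and are in `V`.
The symbol `a` has zero star winding number when it has such a factorization. -/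
structure IsWienerHopf (a apL amL amR apR : SymbolFn) : Prop where
  memV_apL : MemV apL
  memV_amL : MemV amL
  memV_amR : MemV amR
  memV_apR : MemV apR
  plus_apL : IsPlus apL
  minus_amL : IsMinus amL
  minus_amR : IsMinus amR
  plus_apR : IsPlus apR
  log_apL : HasStarLogInV apL
  log_amL : HasStarLogInV amL
  log_amR : HasStarLogInV amR
  log_apR : HasStarLogInV apR
  left_eq : SameSymbol a (starMul apL amL)
  right_eq : SameSymbol a (starMul amR apR)

end

end StarToeplitz

namespace StarToeplitz

/-! ## Operators and their matrices -/

/-! Set φ = a_-^L ⋆ (a_+^R)⁻¹ and ψ = (a_-^R)⁻¹ ⋆ a_+^L. Comparing the two factorizations of a gives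
φ ⋆ ψ = 1. Since L is multiplicative, splitting the intermediate index into positive and nonpositive
values gives T(b ⋆ c) = T(b)T(c) + H(b)H(c^∼) (`toeplitzOp_starMul`), without the Hankel term if b
is a - symbol or c a + symbol. Hence Y = T(φ)T(ψ) = I - H(φ)H(ψ^∼). Moreover Y = T(a_-^L) T(a_+^R)⁻¹
T(a_-^R)⁻¹ T(a_+^L) and T(a) = T(a_-^R) T(a_+^R), so T(a) = T(a_+^L) Y⁻¹ T(a_-^L).

The outer factors are lower and upper triangular, so det T_n(a) is the product of their first n
diagonal elements times the leading n × n minor of Y⁻¹. Jacobi's identity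
(`fredholmDet_mul_det_leading_inverse`, a limit of finite ones) turns this minor into det(Q_n Y Q_n)
/ det Y, where Q_n discards the first n basis vectors. Multiplication by z^{-n} shifts Hankel
indices by n, so Q_n Y Q_n is the operator in the numerator. Its determinant tends to 1 as n grows,
which forces det Y ≠ 0.

Up to the choice of representative, membership in V is exponential decay of the matrix off the
diagonal. Products of Hankel operators then have elements O(r^{j+k}), and the sums of minors
converge absolutely.

It remains to invert the factors within ± symbols in V. A branch of the logarithm excludes 0, so the
spectrum of a factor does not separate 0 from infinity (`IsStarLog.unbounded`). The inverse
therefore stays in the closed algebra of triangular operators (`exists_inverse_mem_triangular`), and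
an argument with exponential weights shows that it decays (`decayMatrix_inverse`). -/

theorem ell2_hasSum_single {ι : Type} [DecidableEq ι] (x : ell2 ι) :
    HasSum (fun i => x i • lp.single 2 i (1 : ℂ)) x := by
  simpa only [← lp.single_smul, smul_eq_mul, mul_one] using
    lp.hasSum_single (E := fun _ : ι => ℂ) (p := 2) (by norm_num) x

/-- The coordinate functional on `ℓ²`. -/
noncomputable def coord {ι : Type} (i : ι) : ell2 ι →L[ℂ] ℂ :=
  LinearMap.mkContinuous ⟨⟨fun x => x i, fun _ _ => rfl⟩, fun _ _ => rfl⟩ 1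
    (fun x => (lp.norm_apply_le_norm (by norm_num) x i).trans_eq (one_mul _).symm)

theorem hasSum_apply {ι : Type} [DecidableEq ι] (A : ell2 ι →L[ℂ] ell2 ι) (x : ell2 ι) (i : ι) :
    HasSum (fun j => entry A i j * x j) (A x i) := by
  have h := ((coord i).comp A).hasSum (ell2_hasSum_single x)
  simp only [map_smul, smul_eq_mul] at h
  simp_rw [mul_comm (entry A i _)]
  exact h

theorem entry_ext {ι : Type} [DecidableEq ι] {A B : ell2 ι →L[ℂ] ell2 ι}
    (h : ∀ i j, entry A i j = entry B i j) : A = B := by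
  ext x i
  have h1 := hasSum_apply A x i
  simp only [h] at h1
  exact h1.unique (hasSum_apply B x i)

theorem entry_mul {ι : Type} [DecidableEq ι] (A B : ell2 ι →L[ℂ] ell2 ι) (i j : ι) :
    HasSum (fun k => entry A i k * entry B k j) (entry (A * B) i j) :=
  hasSum_apply A (B (lp.single 2 j 1)) i

theorem entry_one {ι : Type} [DecidableEq ι] (i j : ι) :
    entry (1 : ell2 ι →L[ℂ] ell2 ι) i j = if i = j then 1 else 0 := by
  simp [entry, Pi.single_apply]

theorem entry_add {ι : Type} [DecidableEq ι] (A B : ell2 ι →L[ℂ] ell2 ι) (i j : ι) :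
    entry (A + B) i j = entry A i j + entry B i j := rfl

theorem entry_sub {ι : Type} [DecidableEq ι] (A B : ell2 ι →L[ℂ] ell2 ι) (i j : ι) :
    entry (A - B) i j = entry A i j - entry B i j := rfl

theorem entry_neg {ι : Type} [DecidableEq ι] (A : ell2 ι →L[ℂ] ell2 ι) (i j : ι) :
    entry (-A) i j = -entry A i j := rfl

theorem entry_smul {ι : Type} [DecidableEq ι] (c : ℂ) (A : ell2 ι →L[ℂ] ell2 ι) (i j : ι) :
    entry (c • A) i j = c * entry A i j := rfl

theorem continuous_entry {ι : Type} [DecidableEq ι] (i j : ι) :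
    Continuous fun A : ell2 ι →L[ℂ] ell2 ι => entry A i j :=
  (coord i).continuous.comp (ContinuousLinearMap.apply ℂ (ell2 ι) (lp.single (E := fun _ : ι => ℂ) 2 j (1 : ℂ))).continuous

theorem matrixOp_eq {ι : Type} [DecidableEq ι] {M : ι → ι → ℂ} {A : ell2 ι →L[ℂ] ell2 ι}
    (h : ∀ i j, entry A i j = M i j) : matrixOp M = A := by
  have hex : ∃ A : ell2 ι →L[ℂ] ell2 ι, ∀ i j, entry A i j = M i j := ⟨A, h⟩
  rw [matrixOp, dif_pos hex]
  exact entry_ext fun i j => (hex.choose_spec i j).trans (h i j).symm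

/-- Tonelli: once the sums are exchanged, column j contributes at most S times its weight. Schur's
test uses the weight ‖x j‖ ^ 2. -/
theorem summable_weighted_rows {ι : Type} (K : ι → ι → ℝ) (w : ι → ℝ) {S : ℝ}
    (hK : ∀ i j, 0 ≤ K i j) (hw : ∀ j, 0 ≤ w j)
    (hcol : ∀ j, Summable fun i => K i j) (hcol' : ∀ j, ∑' i, K i j ≤ S) (hws : Summable w) :
    (Summable fun i => ∑' j, K i j * w j) ∧ ∑' i, ∑' j, K i j * w j ≤ S * ∑' j, w j := by
  have h0 : ∀ p : ι × ι, 0 ≤ K p.2 p.1 * w p.1 := fun p => mul_nonneg (hK _ _) (hw _)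
  have hle : ∀ j, ∑' i, K i j * w j ≤ S * w j := fun j => by
    rw [tsum_mul_right]
    exact mul_le_mul_of_nonneg_right (hcol' j) (hw j)
  have hp : Summable fun p : ι × ι => K p.2 p.1 * w p.1 := by
    rw [summable_prod_of_nonneg h0]
    refine ⟨fun j => (hcol j).mul_right (w j), Summable.of_nonneg_of_le
      (fun j => ?_) hle (hws.mul_left S)⟩
    exact tsum_nonneg fun i => h0 (j, i)
  have hps : Summable fun p : ι × ι => K p.1 p.2 * w p.2 :=
    (Equiv.prodComm ι ι).summable_iff.mp hp
  refine ⟨hps.prod, ?_⟩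
  rw [Summable.tsum_comm (f := fun j i => K i j * w j) hp, ← tsum_mul_left]
  exact hp.prod.tsum_le_tsum hle (hws.mul_left S)

/-- Schur's test: uniformly absolutely summable rows and columns give a bounded operator. -/
theorem schur_test {ι : Type} [DecidableEq ι] (M : ι → ι → ℂ) (S : ℝ) (hS : 0 ≤ S)
    (hrow : ∀ i, Summable fun j => ‖M i j‖) (hrow' : ∀ i, ∑' j, ‖M i j‖ ≤ S)
    (hcol : ∀ j, Summable fun i => ‖M i j‖) (hcol' : ∀ j, ∑' i, ‖M i j‖ ≤ S) :
    ∃ A : ell2 ι →L[ℂ] ell2 ι, ‖A‖ ≤ S ∧ ∀ i j, entry A i j = M i j := by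
  have hsq : ∀ x : ell2 ι, HasSum (fun i => ‖x i‖ ^ 2) (‖x‖ ^ 2) := fun x => by
    have := lp.hasSum_norm (p := 2) (by norm_num) x
    simpa using this
  have hbd : ∀ (x : ell2 ι) i, ‖x i‖ ≤ ‖x‖ := fun x i => lp.norm_apply_le_norm (by norm_num) x i
  have hs1 : ∀ (x : ell2 ι) i, Summable fun j => ‖M i j * x j‖ := fun x i => by
    refine Summable.of_nonneg_of_le (fun _ => norm_nonneg _) (fun j => ?_) ((hrow i).mul_right ‖x‖)
    rw [norm_mul]; gcongr; exact hbd x j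
  have hs2 : ∀ (x : ell2 ι) i, Summable fun j => ‖M i j‖ * ‖x j‖ ^ 2 := fun x i => by
    refine Summable.of_nonneg_of_le (fun _ => by positivity) (fun j => ?_)
      ((hrow i).mul_right (‖x‖ ^ 2))
    gcongr; exact hbd x j
  have hcs : ∀ (x : ell2 ι) i,
      ‖∑' j, M i j * x j‖ ^ 2 ≤ S * ∑' j, ‖M i j‖ * ‖x j‖ ^ 2 := fun x i => by
    have h1 : ‖∑' j, M i j * x j‖ ≤ ∑' j, ‖M i j‖ * ‖x j‖ := by
      simpa only [norm_mul] using norm_tsum_le_tsum_norm (hs1 x i)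
    -- Cauchy–Schwarz with weights ‖M i j‖, on partial sums and then in the limit.
    have h2 : (∑' j, ‖M i j‖ * ‖x j‖) ^ 2 ≤ (∑' j, ‖M i j‖) * ∑' j, ‖M i j‖ * ‖x j‖ ^ 2 := by
      have hs1' : Summable fun j => ‖M i j‖ * ‖x j‖ := by simpa only [norm_mul] using hs1 x i
      refine le_of_tendsto_of_tendsto' (hs1'.hasSum.pow 2)
        (Filter.Tendsto.mul (hrow i).hasSum (hs2 x i).hasSum) fun s => ?_
      refine Finset.sum_sq_le_sum_mul_sum_of_sq_le_mul s (fun _ _ => norm_nonneg _)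
        (fun _ _ => by positivity) (fun _ _ => by apply le_of_eq; ring)
    calc _ ≤ (∑' j, ‖M i j‖ * ‖x j‖) ^ 2 := by gcongr
      _ ≤ _ := h2
      _ ≤ _ := by exact mul_le_mul_of_nonneg_right (hrow' i) (tsum_nonneg fun _ => by positivity)
  have hs3 : ∀ x : ell2 ι, Summable (fun i => ∑' j, ‖M i j‖ * ‖x j‖ ^ 2) ∧
      ∑' i, ∑' j, ‖M i j‖ * ‖x j‖ ^ 2 ≤ S * ‖x‖ ^ 2 := fun x => by
    rw [← (hsq x).tsum_eq]
    exact summable_weighted_rows (fun i j => ‖M i j‖) (fun j => ‖x j‖ ^ 2)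
      (fun _ _ => norm_nonneg _) (fun _ => by positivity) hcol hcol' (hsq x).summable
  have hs4 : ∀ x : ell2 ι, Memℓp (fun i => ∑' j, M i j * x j) 2 := fun x => by
    refine memℓp_gen ?_
    simpa using Summable.of_nonneg_of_le (fun _ => by positivity) (hcs x) ((hs3 x).1.mul_left S)
  let A₀ : ell2 ι →ₗ[ℂ] ell2 ι :=
    { toFun := fun x => ⟨fun i => ∑' j, M i j * x j, hs4 x⟩
      map_add' := fun x y => by
        ext i
        simp only [lp.coeFn_add, Pi.add_apply, mul_add]
        exact ((hs1 x i).of_norm).tsum_add (hs1 y i).of_norm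
      map_smul' := fun c x => by
        ext i
        simp only [lp.coeFn_smul, Pi.smul_apply, smul_eq_mul, RingHom.id_apply, ← tsum_mul_left]
        exact tsum_congr fun j => by ring }
  have hA₀ : ∀ x, ‖A₀ x‖ ≤ S * ‖x‖ := fun x => by
    refine abs_le_of_sq_le_sq' ?_ (by positivity) |>.2
    rw [← (hsq (A₀ x)).tsum_eq]
    calc _ ≤ ∑' i, S * ∑' j, ‖M i j‖ * ‖x j‖ ^ 2 :=
          (hsq (A₀ x)).summable.tsum_le_tsum (hcs x) ((hs3 x).1.mul_left S)
      _ = S * ∑' i, ∑' j, ‖M i j‖ * ‖x j‖ ^ 2 := tsum_mul_left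
      _ ≤ S * (S * ‖x‖ ^ 2) := by gcongr; exact (hs3 x).2
      _ = _ := by ring
  refine ⟨A₀.mkContinuous S hA₀, A₀.mkContinuous_norm_le hS hA₀, fun i j => ?_⟩
  change ∑' k, M i k * lp.single (E := fun _ : ι => ℂ) 2 j (1 : ℂ) k = M i j
  rw [tsum_eq_single j fun k hk => by rw [lp.single_apply_ne _ _ _ hk, mul_zero]]
  simp

/-! ## Fourier coefficients with exponential decay -/

/-- The Fourier coefficients decay exponentially, uniformly in the position. -/
def CoeffDecay (a : SymbolFn) : Prop :=
  ∃ C r : ℝ, 0 ≤ C ∧ 0 < r ∧ r < 1 ∧ ∀ N k, ‖coeff (a N) k‖ ≤ C * r ^ k.natAbs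

/-- The matrix elements decay exponentially off the diagonal. -/
def DecayMatrix (M : ℤ → ℤ → ℂ) : Prop :=
  ∃ C r : ℝ, 0 ≤ C ∧ 0 < r ∧ r < 1 ∧ ∀ j k, ‖M j k‖ ≤ C * r ^ (j - k).natAbs

theorem CoeffDecay.decayMatrix {a : SymbolFn} (h : CoeffDecay a) :
    DecayMatrix (laurentEntry a) := by
  obtain ⟨C, r, hC, h0, h1, h⟩ := h
  exact ⟨C, r, hC, h0, h1, fun j k => h _ _⟩

theorem summable_pow_natAbs {r : ℝ} (h0 : 0 ≤ r) (h1 : r < 1) :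
    Summable fun k : ℤ => r ^ k.natAbs := by
  have h := summable_geometric_of_lt_one h0 h1
  refine Summable.of_nat_of_neg ?_ ?_ <;> simpa using h

theorem natAbs_add_pow_le {r : ℝ} (h0 : 0 ≤ r) (h1 : r ≤ 1) (m n : ℤ) :
    r ^ (m.natAbs + n.natAbs) ≤ r ^ (m + n).natAbs :=
  pow_le_pow_of_le_one h0 h1 (Int.natAbs_add_le m n)

theorem coeff_zpow_mul (e k : ℤ) (c : ℂ) :
    coeff (fun z => (z : ℂ) ^ e * c) k = if e = k then c else 0 := by
  have h1 : ∀ p : ℝ, ((Circle.exp p : Circle) : ℂ) ^ e * c *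
      Complex.exp (-(Complex.I * (k : ℂ) * (p : ℂ))) =
      c * Complex.exp ((Complex.I * ((e - k : ℤ) : ℂ)) * (p : ℂ)) := fun p => by
    rw [Circle.coe_exp, ← Complex.exp_int_mul, mul_right_comm, ← Complex.exp_add, mul_comm]
    congr 2
    push_cast
    ring
  have hpi : (Real.pi : ℂ) ≠ 0 := by exact_mod_cast Real.pi_ne_zero
  simp only [coeff, h1]
  rw [intervalIntegral.integral_const_mul]
  split_ifs with hek
  · subst hek
    simp
    field_simp
    ring
  · have hc : Complex.I * ((e - k : ℤ) : ℂ) ≠ 0 :=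
      mul_ne_zero Complex.I_ne_zero (by exact_mod_cast sub_ne_zero.mpr hek)
    rw [integral_exp_mul_complex hc]
    have : Complex.exp (Complex.I * ((e - k : ℤ) : ℂ) * (Real.pi : ℂ)) =
        Complex.exp (Complex.I * ((e - k : ℤ) : ℂ) * ((-Real.pi : ℝ) : ℂ)) := by
      rw [← Complex.exp_periodic.int_mul (e - k)
        (Complex.I * ((e - k : ℤ) : ℂ) * ((-Real.pi : ℝ) : ℂ))]
      congr 1
      push_cast
      ring
    rw [this]
    simp

theorem coeff_tsum {ι : Type} [Countable ι] (c : ι → ℂ) (e : ι → ℤ)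
    (hc : Summable fun i => ‖c i‖) (k : ℤ) :
    coeff (fun z => ∑' i, (z : ℂ) ^ e i * c i) k = ∑' i, if e i = k then c i else 0 := by
  have hn : ∀ (z : Circle) i, ‖(z : ℂ) ^ e i * c i‖ = ‖c i‖ := fun z i => by
    rw [norm_mul, norm_zpow, Circle.norm_coe, one_zpow, one_mul]
  have h := intervalIntegral.hasSum_integral_of_dominated_convergence (μ := MeasureTheory.volume)
    (a := -Real.pi) (b := Real.pi)
    (F := fun i (p : ℝ) => ((Circle.exp p : Circle) : ℂ) ^ e i * c i *
      Complex.exp (-(Complex.I * (k : ℂ) * (p : ℂ))))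
    (f := fun p => (∑' i, ((Circle.exp p : Circle) : ℂ) ^ e i * c i) *
      Complex.exp (-(Complex.I * (k : ℂ) * (p : ℂ))))
    (fun i _ => ‖c i‖) (fun i => ?_) (fun i => ?_) (.of_forall fun _ _ => hc) (by simp)
    (.of_forall fun p _ => ?_)
  · have h' := h.mul_left (1 / (2 * (Real.pi : ℂ)))
    simp only [← coeff_zpow_mul]
    exact h'.tsum_eq.symm
  · refine Continuous.aestronglyMeasurable ?_
    simp_rw [Circle.coe_exp, ← Complex.exp_int_mul]
    fun_prop
  · refine .of_forall fun p _ => ?_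
    rw [norm_mul, hn, Complex.norm_exp]
    simp
  · refine HasSum.mul_right _ (Summable.hasSum (Summable.of_norm ?_))
    simpa only [hn] using hc

theorem coeff_one (k : ℤ) : coeff (fun _ => 1) k = if k = 0 then 1 else 0 := by
  have := coeff_zpow_mul 0 k 1
  simpa [eq_comm] using this

theorem laurentEntry_oneSymbol (j k : ℤ) : laurentEntry oneSymbol j k = if j = k then 1 else 0 := by
  simp only [laurentEntry]
  refine (coeff_one _).trans ?_
  simp only [sub_eq_zero]

theorem coeff_zpowSymbol (m N k : ℤ) : coeff (zpowSymbol m N) k = if m = k then 1 else 0 := by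
  have := coeff_zpow_mul m k 1
  simp only [mul_one] at this
  exact this

theorem laurentEntry_zpowSymbol (m j k : ℤ) :
    laurentEntry (zpowSymbol m) j k = if m = j - k then 1 else 0 := coeff_zpowSymbol m (j + k) (j - k)

theorem coeffDecay_zpowSymbol (m : ℤ) : CoeffDecay (zpowSymbol m) := by
  refine ⟨2 ^ m.natAbs, 1 / 2, by positivity, by norm_num, by norm_num, fun N k => ?_⟩
  rw [coeff_zpowSymbol]
  split_ifs with h
  · subst h
    rw [← mul_pow]; norm_num
  · rw [norm_zero]; positivity

theorem coeff_reflect (a : SymbolFn) (N k : ℤ) :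
    coeff (reflect a N) k = coeff (a (2 - N)) (-k) := by
  have h := intervalIntegral.integral_comp_neg (a := -Real.pi) (b := Real.pi)
    (fun p : ℝ => a (2 - N) (Circle.exp p) * Complex.exp (-(Complex.I * ((-k : ℤ) : ℂ) * (p : ℂ))))
  rw [neg_neg] at h
  rw [coeff, coeff, ← h]
  simp [reflect]

theorem CoeffDecay.reflect {a : SymbolFn} (h : CoeffDecay a) : CoeffDecay (reflect a) := by
  obtain ⟨C, r, hC, h0, h1, h⟩ := h
  refine ⟨C, r, hC, h0, h1, fun N k => ?_⟩
  rw [coeff_reflect]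
  simpa using h (2 - N) (-k)

theorem laurentEntry_reflect (a : SymbolFn) (j k : ℤ) :
    laurentEntry (reflect a) j k = laurentEntry a (1 - j) (1 - k) := by
  rw [laurentEntry, coeff_reflect, laurentEntry]
  congr 1 <;> [congr 1; skip] <;> ring

theorem CoeffDecay.common {a b : SymbolFn} (ha : CoeffDecay a) (hb : CoeffDecay b) :
    ∃ C r : ℝ, 0 ≤ C ∧ 0 < r ∧ r < 1 ∧ (∀ N k, ‖coeff (a N) k‖ ≤ C * r ^ k.natAbs) ∧
      ∀ N k, ‖coeff (b N) k‖ ≤ C * r ^ k.natAbs := by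
  obtain ⟨C, r, hC, h0, h1, h⟩ := ha
  obtain ⟨C', r', hC', h0', h1', h'⟩ := hb
  refine ⟨max C C', max r r', le_max_of_le_left hC, lt_max_of_lt_left h0, max_lt h1 h1',
    fun N k => (h N k).trans ?_, fun N k => (h' N k).trans ?_⟩ <;> gcongr <;> simp

/-- Decay makes the double series absolutely convergent, so it can be integrated term by term; only
the pairs with m + n = k survive. -/
theorem coeff_starMul {a b : SymbolFn} (ha : CoeffDecay a) (hb : CoeffDecay b) (N k : ℤ) :
    coeff (starMul a b N) k = ∑' n, coeff (a (N + (k - n))) n * coeff (b (N - n)) (k - n) := by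
  obtain ⟨C, r, hC, h0, h1, ha, hb⟩ := ha.common hb
  have hs : Summable fun p : ℤ × ℤ => ‖coeff (a (N + p.1)) p.2 * coeff (b (N - p.2)) p.1‖ := by
    refine Summable.of_nonneg_of_le (fun _ => norm_nonneg _) (fun p => ?_)
      (((summable_pow_natAbs h0.le h1).mul_left C).mul_of_nonneg
        ((summable_pow_natAbs h0.le h1).mul_left C) (fun _ => by positivity)
        (fun _ => by positivity))
    rw [norm_mul, mul_comm]
    gcongr
    exacts [hb _ _, ha _ _]
  have hz : starMul a b N = fun z : Circle => ∑' p : ℤ × ℤ, (z : ℂ) ^ (p.1 + p.2) *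
      (coeff (a (N + p.1)) p.2 * coeff (b (N - p.2)) p.1) := by
    ext z
    refine (Summable.tsum_prod (f := fun p : ℤ × ℤ => (z : ℂ) ^ (p.1 + p.2) *
      (coeff (a (N + p.1)) p.2 * coeff (b (N - p.2)) p.1)) (Summable.of_norm ?_)).symm
    simpa only [norm_mul, norm_zpow, Circle.norm_coe, one_zpow, one_mul] using hs
  rw [hz, coeff_tsum _ _ hs]
  have hinj : Function.Injective fun n : ℤ => (k - n, n) := fun m n h => (Prod.ext_iff.mp h).2
  rw [← hinj.tsum_eq]
  · simp
  · rintro ⟨m, n⟩ h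
    refine ⟨n, ?_⟩
    have : m + n = k := by
      by_contra hne
      simp [hne] at h
    simp [← this]

theorem CoeffDecay.starMul {a b : SymbolFn} (ha : CoeffDecay a) (hb : CoeffDecay b) :
    CoeffDecay (starMul a b) := by
  have hc := coeff_starMul ha hb
  obtain ⟨C, r, hC, h0, h1, ha, hb⟩ := ha.common hb
  -- Convolving r^|n| with itself costs a factor growing with |k|, so the rate is relaxed to some s
  -- > r; the surplus (r/s)^|n| is summable.
  obtain ⟨s, hrs, hs1⟩ := exists_between h1
  have hs0 := h0.trans hrs
  have hq : Summable fun n : ℤ => (r / s) ^ n.natAbs :=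
    summable_pow_natAbs (by positivity) ((div_lt_one hs0).mpr hrs)
  refine ⟨C * C * ∑' n : ℤ, (r / s) ^ n.natAbs, s,
    mul_nonneg (mul_nonneg hC hC) (tsum_nonneg fun _ => by positivity), hs0, hs1, fun N k => ?_⟩
  have hle : ∀ n, ‖coeff (a (N + (k - n))) n * coeff (b (N - n)) (k - n)‖ ≤
      C * C * s ^ k.natAbs * (r / s) ^ n.natAbs := fun n => by
    calc _ ≤ (C * r ^ n.natAbs) * (C * r ^ (k - n).natAbs) := by
          rw [norm_mul]; gcongr; exacts [ha _ _, hb _ _]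
      _ ≤ (C * r ^ n.natAbs) * (C * s ^ (k - n).natAbs) := by gcongr
      _ = C * C * s ^ (n.natAbs + (k - n).natAbs) * (r / s) ^ n.natAbs := by
          rw [div_pow, pow_add]; field_simp
      _ ≤ _ := by
          gcongr C * C * ?_ * _
          simpa using natAbs_add_pow_le hs0.le hs1.le n (k - n)
  rw [hc]
  refine (tsum_of_norm_bounded (hq.mul_left _).hasSum hle).trans_eq ?_
  rw [tsum_mul_left]; ring

/-- The half-integer shifts of the Moyal product are exactly what makes L multiplicative: with n = j
- l the two positions become (j + l)/2 and (l + k)/2. -/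
theorem laurentEntry_starMul {a b : SymbolFn} (ha : CoeffDecay a) (hb : CoeffDecay b) (j k : ℤ) :
    laurentEntry (starMul a b) j k = ∑' l, laurentEntry a j l * laurentEntry b l k := by
  rw [laurentEntry, coeff_starMul ha hb, ← (Equiv.subLeft j).tsum_eq]
  refine tsum_congr fun l => ?_
  simp only [Equiv.subLeft_apply, laurentEntry]
  ring_nf

/-! ## The class `V` -/

theorem isOpen_annulus (ρ : ℝ) : IsOpen (annulus ρ) :=
  (isOpen_lt continuous_const continuous_norm).inter (isOpen_lt continuous_norm continuous_const)

theorem coeff_eq_circleIntegral {g : Circle → ℂ} {F : ℂ → ℂ} (hF : ∀ z : Circle, F z = g z)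
    (k : ℤ) : coeff g k = (2 * Real.pi * Complex.I : ℂ)⁻¹ *
      ∮ z in C(0, 1), (z - 0)⁻¹ • (z ^ (-k) * F z) := by
  have h1 : ∀ θ : ℝ, deriv (circleMap 0 1) θ • ((circleMap 0 1 θ - 0)⁻¹ •
      (circleMap 0 1 θ ^ (-k) * F (circleMap 0 1 θ))) =
      Complex.I * (g (Circle.exp θ) * Complex.exp (-(Complex.I * (k : ℂ) * (θ : ℂ)))) := fun θ => by
    have h2 : circleMap 0 1 θ = (Circle.exp θ : ℂ) := by simp [circleMap]
    have h3 : Complex.exp (-(Complex.I * (k : ℂ) * (θ : ℂ))) = (Circle.exp θ : ℂ) ^ (-k) := by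
      rw [Circle.coe_exp, ← Complex.exp_int_mul]
      congr 1
      push_cast
      ring
    have h4 : (Circle.exp θ : ℂ) ≠ 0 := Circle.coe_ne_zero _
    rw [deriv_circleMap, h2, hF, h3, sub_zero, smul_eq_mul, smul_eq_mul]
    field_simp
  have hper : Function.Periodic (fun p : ℝ => g (Circle.exp p) *
      Complex.exp (-(Complex.I * (k : ℂ) * (p : ℂ)))) (2 * Real.pi) := fun p => by
    simp only [Circle.exp_add_two_pi]
    rw [← Complex.exp_periodic.int_mul (-k) (-(Complex.I * (k : ℂ) * (p : ℂ)))]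
    congr 2
    push_cast
    ring
  have h5 := hper.intervalIntegral_add_eq 0 (-Real.pi)
  rw [zero_add, show -Real.pi + 2 * Real.pi = Real.pi by ring] at h5
  have hpi : (Real.pi : ℂ) ≠ 0 := by exact_mod_cast Real.pi_ne_zero
  rw [circleIntegral]
  simp only [h1]
  rw [intervalIntegral.integral_const_mul, h5, coeff]
  field_simp

/-- Cauchy's estimate on the circle of radius R, to which the unit circle is deformed inside the
annulus. -/
theorem norm_coeff_le {ρ R M : ℝ} (hρ : 0 < ρ) {g : Circle → ℂ} {F : ℂ → ℂ}
    (hd : DifferentiableOn ℂ F (annulus ρ)) (hF : ∀ z : Circle, F z = g z)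
    (hM : ∀ z ∈ annulus ρ, ‖F z‖ ≤ M) (hρ1 : ρ < 1) (hR : ρ < R) (hR' : R < ρ⁻¹) (k : ℤ) :
    ‖coeff g k‖ ≤ M * R ^ (-k) := by
  have hR0 := hρ.trans hR
  have hd' : ∀ z ∈ annulus ρ, DifferentiableAt ℂ (fun z => z ^ (-k) * F z) z := fun z hz =>
    (differentiableAt_zpow.mpr (.inl (norm_pos_iff.mp (hρ.trans hz.1)))).mul
      (hd.differentiableAt ((isOpen_annulus ρ).mem_nhds hz))
  have deform : ∀ r' R' : ℝ, ρ < r' → r' ≤ R' → R' < ρ⁻¹ →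
      (∮ z in C(0, R'), (z - 0)⁻¹ • (z ^ (-k) * F z)) =
        ∮ z in C(0, r'), (z - 0)⁻¹ • (z ^ (-k) * F z) := fun r' R' h1 h2 h3 => by
    refine Complex.circleIntegral_sub_center_inv_smul_eq_of_differentiable_on_annulus_off_countable
      (hρ.trans h1) h2 Set.countable_empty (fun z hz => ?_) (fun z hz => ?_)
    · refine (hd' z ⟨?_, ?_⟩).continuousAt.continuousWithinAt
      · simpa using h1.trans_le (by simpa using hz.2)
      · exact (by simpa using hz.1 : ‖z‖ ≤ R').trans_lt h3
    · refine hd' z ⟨?_, ?_⟩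
      · exact h1.trans (by simpa using hz.1.2)
      · exact (by simpa using hz.1.1 : ‖z‖ < R').trans h3
  have heq : (∮ z in C(0, 1), (z - 0)⁻¹ • (z ^ (-k) * F z)) =
      ∮ z in C(0, R), (z - 0)⁻¹ • (z ^ (-k) * F z) := by
    rcases le_total 1 R with h | h
    · exact (deform 1 R hρ1 h hR').symm
    · exact deform R 1 hR h ((one_lt_inv₀ hρ).mpr hρ1)
  rw [coeff_eq_circleIntegral hF, heq]
  have hb := circleIntegral.norm_integral_le_of_norm_le_const (c := 0) (R := R)
    (f := fun z => (z - 0)⁻¹ • (z ^ (-k) * F z)) (C := R⁻¹ * (R ^ (-k) * M)) hR0.le fun z hz => by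
      have hz' : ‖z‖ = R := by simpa using hz
      rw [sub_zero, norm_smul, norm_mul, norm_inv, norm_zpow, hz']
      gcongr
      exact hM z ⟨hz' ▸ hR, hz' ▸ hR'⟩
  rw [norm_mul, norm_inv]
  calc _ ≤ ‖(2 * Real.pi * Complex.I : ℂ)‖⁻¹ * (2 * Real.pi * R * (R⁻¹ * (R ^ (-k) * M))) := by
        gcongr
    _ = _ := by
        have := Real.pi_pos
        simp [abs_of_pos this]
        field_simp

theorem MemV.coeffDecay {a : SymbolFn} (h : MemV a) : CoeffDecay a := by
  obtain ⟨ρ, h0, h1, F, hd, hF, M, hM⟩ := h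
  obtain ⟨s, hs, hs1⟩ := exists_between h1
  have hs0 := h0.trans hs
  have hM0 : 0 ≤ M := (norm_nonneg _).trans
    (hM 0 1 ⟨by simpa using h1, by simpa using (one_lt_inv₀ h0).mpr h1⟩)
  refine ⟨M, s, hM0, hs0, hs1, fun N k => ?_⟩
  -- The circle moves outwards for k ≥ 0 and inwards for k ≤ 0; both choices give s^|k|.
  rcases le_total 0 k with hk | hk
  · refine (norm_coeff_le h0 (hd N) (hF N) (hM N) h1 (R := s⁻¹)
      (h1.trans ((one_lt_inv₀ hs0).mpr hs1)) (inv_strictAnti₀ h0 hs) k).trans_eq ?_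
    rw [inv_zpow', neg_neg, ← zpow_natCast, Int.natAbs_of_nonneg hk]
  · refine (norm_coeff_le h0 (hd N) (hF N) (hM N) h1 (R := s) hs
      (hs1.trans ((one_lt_inv₀ h0).mpr h1)) k).trans_eq ?_
    rw [← zpow_natCast, Int.ofNat_natAbs_of_nonpos hk]

/-- A symbol with the prescribed star-Laurent matrix. -/
noncomputable def symbolOfMatrix (M : ℤ → ℤ → ℂ) : SymbolFn := fun N z =>
  ∑' k : ℤ, (z : ℂ) ^ k * M ((N + k) / 2) ((N - k) / 2)

/-- For odd `N + k` the divisions round, but `N + k` and `N - k` have the same parity, so the two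
indices still differ by `k`. These coefficients enter no star-Laurent element, yet must decay for
membership in V. -/
theorem DecayMatrix.norm_le {M : ℤ → ℤ → ℂ} {C r : ℝ}
    (h : ∀ j k, ‖M j k‖ ≤ C * r ^ (j - k).natAbs) (N k : ℤ) :
    ‖M ((N + k) / 2) ((N - k) / 2)‖ ≤ C * r ^ k.natAbs := by
  convert h ((N + k) / 2) ((N - k) / 2) using 4
  omega

theorem DecayMatrix.memV_symbolOfMatrix {M : ℤ → ℤ → ℂ} (h : DecayMatrix M) :
    MemV (symbolOfMatrix M) := by
  obtain ⟨C, r, hC, h0, h1, h⟩ := h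
  obtain ⟨ρ, hr, hρ1⟩ := exists_between h1
  have hρ0 := h0.trans hr
  have hs : Summable fun k : ℤ => C * (r / ρ) ^ k.natAbs :=
    (summable_pow_natAbs (by positivity) ((div_lt_one hρ0).mpr hr)).mul_left C
  have hb : ∀ (N k : ℤ), ∀ z ∈ annulus ρ,
      ‖z ^ k * M ((N + k) / 2) ((N - k) / 2)‖ ≤ C * (r / ρ) ^ k.natAbs := fun N k z hz => by
    have hz0 : 0 < ‖z‖ := hρ0.trans hz.1
    have hzk : ‖z ^ k‖ ≤ (ρ⁻¹) ^ k.natAbs := by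
      rw [norm_zpow]
      rcases le_total 0 k with hk | hk
      · lift k to ℕ using hk
        simp only [zpow_natCast, Int.natAbs_natCast]
        gcongr; exact hz.2.le
      · obtain ⟨n, rfl⟩ : ∃ n : ℕ, k = -n := ⟨k.natAbs, by omega⟩
        simp only [zpow_neg, zpow_natCast, Int.natAbs_neg, Int.natAbs_natCast, ← inv_pow]
        gcongr; exact hz.1.le
    rw [norm_mul, div_eq_mul_inv, mul_pow, mul_comm (r ^ _), mul_left_comm]
    gcongr
    exact norm_le h N k
  refine ⟨ρ, hρ0, hρ1, fun N z => ∑' k : ℤ, z ^ k * M ((N + k) / 2) ((N - k) / 2), fun N => ?_,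
    fun N z => rfl, _, fun N z hz => tsum_of_norm_bounded hs.hasSum fun k => hb N k z hz⟩
  refine Complex.differentiableOn_tsum_of_summable_norm hs (fun k z hz => ?_) (isOpen_annulus ρ) (hb N)
  have hz0 : z ≠ 0 := norm_pos_iff.mp (hρ0.trans hz.1)
  exact ((differentiableAt_zpow.mpr (.inl hz0)).mul_const _).differentiableWithinAt

theorem DecayMatrix.laurentEntry_symbolOfMatrix {M : ℤ → ℤ → ℂ} (h : DecayMatrix M) (j k : ℤ) :
    laurentEntry (symbolOfMatrix M) j k = M j k := by
  obtain ⟨C, r, hC, h0, h1, h⟩ := h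
  have hs : Summable fun i : ℤ => ‖M ((j + k + i) / 2) ((j + k - i) / 2)‖ :=
    Summable.of_nonneg_of_le (fun _ => norm_nonneg _) (norm_le h (j + k))
      ((summable_pow_natAbs h0.le h1).mul_left C)
  rw [laurentEntry]
  refine (coeff_tsum _ _ hs (j - k)).trans ?_
  rw [tsum_eq_single (j - k) fun i hi => if_neg hi, if_pos rfl]
  congr 1 <;> omega

/-- A matrix dominated by a summable function of the distance to the diagonal, with rows and
columns selected injectively, defines a bounded operator. -/
theorem exists_op_of_diagonal_bound {M : ℤ → ℤ → ℂ} {φ : ℤ → ℝ} (hs : Summable φ)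
    (hφ : ∀ d, 0 ≤ φ d) (h : ∀ j k, ‖M j k‖ ≤ φ (j - k)) {ι : Type} [DecidableEq ι]
    {f g : ι → ℤ} (hf : f.Injective) (hg : g.Injective) :
    ∃ A : ell2 ι →L[ℂ] ell2 ι, ‖A‖ ≤ ∑' d, φ d ∧ ∀ i j, entry A i j = M (f i) (g j) := by
  have key : ∀ (u : ι → ℤ) (w : ι → ℂ), u.Injective → (∀ i, ‖w i‖ ≤ φ (u i)) →
      Summable (fun i => ‖w i‖) ∧ ∑' i, ‖w i‖ ≤ ∑' d, φ d := fun u w hu hw => by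
    have h2 : Summable fun i => φ (u i) := hs.comp_injective hu
    have h3 := Summable.of_nonneg_of_le (fun _ => norm_nonneg _) hw h2
    exact ⟨h3, (h3.tsum_le_tsum hw h2).trans (tsum_comp_le_tsum_of_inj hs hφ hu)⟩
  have hr := fun i => key (fun j => f i - g j) (fun j => M (f i) (g j))
    (fun x y hxy => hg (by simpa using hxy)) fun j => h _ _
  have hc := fun j => key (fun i => f i - g j) (fun i => M (f i) (g j))
    (fun x y hxy => hf (by simpa using hxy)) fun i => h _ _
  exact schur_test (fun i j => M (f i) (g j)) _ (tsum_nonneg hφ) (fun i => (hr i).1)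
    (fun i => (hr i).2) (fun i => (hc i).1) (fun i => (hc i).2)

theorem DecayMatrix.exists_op {M : ℤ → ℤ → ℂ} (h : DecayMatrix M) {ι : Type} [DecidableEq ι]
    {f g : ι → ℤ} (hf : f.Injective) (hg : g.Injective) :
    ∃ A : ell2 ι →L[ℂ] ell2 ι, ∀ i j, entry A i j = M (f i) (g j) := by
  obtain ⟨C, r, hC, h0, h1, h⟩ := h
  obtain ⟨A, -, hA⟩ := exists_op_of_diagonal_bound ((summable_pow_natAbs h0.le h1).mul_left C)
    (fun _ => by positivity) h hf hg
  exact ⟨A, hA⟩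

/-! ### Star-Laurent, star-Toeplitz and star-Hankel operators of decaying symbols -/

theorem CoeffDecay.entry_laurentOp {a : SymbolFn} (ha : CoeffDecay a) (j k : ℤ) :
    entry (laurentOp a) j k = laurentEntry a j k := by
  obtain ⟨A, hA⟩ := ha.decayMatrix.exists_op Function.injective_id Function.injective_id
  rw [laurentOp, matrixOp_eq (A := A) (M := laurentEntry a) hA]; exact hA j k

theorem injective_succ : Function.Injective fun k : ℕ => (k : ℤ) + 1 := fun a b h => by
  simpa using h

theorem injective_neg_nat : Function.Injective fun k : ℕ => -(k : ℤ) := fun a b h => by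
  simpa using h

theorem CoeffDecay.entry_toeplitzOp {a : SymbolFn} (ha : CoeffDecay a) (j k : ℕ) :
    entry (toeplitzOp a) j k = laurentEntry a (j + 1) (k + 1) := by
  obtain ⟨A, hA⟩ := ha.decayMatrix.exists_op injective_succ injective_succ
  rw [toeplitzOp, matrixOp_eq hA]; exact hA j k

/-- H_{j,k} = L_{j,1-k}: the star-Hankel matrix is the block of the star-Laurent matrix with
positive rows and nonpositive columns. -/
theorem CoeffDecay.entry_hankelOp {a : SymbolFn} (ha : CoeffDecay a) (j k : ℕ) :
    entry (hankelOp a) j k = laurentEntry a (j + 1) (-k) := by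
  obtain ⟨A, hA⟩ := ha.decayMatrix.exists_op injective_succ injective_neg_nat
  rw [hankelOp, matrixOp_eq (A := A) fun i j => ?_]
  · exact hA j k
  · rw [hA, hankelEntry, laurentEntry]
    ring_nf

theorem CoeffDecay.laurentOp_starMul {a b : SymbolFn} (ha : CoeffDecay a)
    (hb : CoeffDecay b) : laurentOp (StarToeplitz.starMul a b) = laurentOp a * laurentOp b :=
  entry_ext fun j k => by
    rw [(ha.starMul hb).entry_laurentOp, laurentEntry_starMul ha hb, ← (entry_mul _ _ j k).tsum_eq]
    simp only [ha.entry_laurentOp, hb.entry_laurentOp]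

section
open MeasureTheory Set

/-! ## Winding numbers -/

theorem IsSimpleClosedCurve.bound {γ : ℝ → ℂ} (h : IsSimpleClosedCurve γ) :
    ∃ C : ℝ, ∀ᵐ t : ℝ, t ∈ Ioc (0 : ℝ) 1 → ‖deriv γ t‖ ≤ C := by
  obtain ⟨s, -, -, C, hC⟩ := h.piecewise
  refine ⟨C, ?_⟩
  have h1 : ∀ᵐ t : ℝ, t ∉ insert 1 (s : Set ℝ) :=
    measure_eq_zero_iff_ae_notMem.mp ((s.countable_toSet.insert 1).measure_zero _)
  filter_upwards [h1] with t ht ht'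
  refine hC t ⟨⟨ht'.1, lt_of_le_of_ne ht'.2 fun h => ht (by simp [h])⟩, fun h => ht ?_⟩
  exact mem_insert_of_mem _ h

theorem IsSimpleClosedCurve.intervalIntegrable {γ : ℝ → ℂ} (h : IsSimpleClosedCurve γ)
    {g : ℝ → ℂ} (hg : ContinuousOn g (Icc 0 1)) :
    IntervalIntegrable (fun t => deriv γ t * g t) volume 0 1 := by
  obtain ⟨C, hC⟩ := h.bound
  have hd : IntervalIntegrable (deriv γ) volume 0 1 := by
    rw [intervalIntegrable_iff_integrableOn_Ioc_of_le zero_le_one]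
    refine Measure.integrableOn_of_bounded (M := C) (by simp)
      (measurable_deriv γ).aestronglyMeasurable ?_
    exact (ae_restrict_iff' measurableSet_Ioc).mpr hC
  exact hd.mul_continuousOn (by rwa [uIcc_of_le zero_le_one])

/-- The quotient (γ - w₁)/(γ - w₀) stays in the unit disc about 1, so its principal logarithm is a
primitive of the difference of the integrands, and the curve is closed. -/
theorem windingNumber_eq_of_norm_lt {γ : ℝ → ℂ} (h : IsSimpleClosedCurve γ) {w₀ w₁ : ℂ} {δ : ℝ}
    (hδ : ∀ t ∈ Icc (0 : ℝ) 1, δ ≤ ‖γ t - w₀‖) (hw : ‖w₁ - w₀‖ < δ) :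
    windingNumber γ w₁ = windingNumber γ w₀ := by
  have hδ0 : 0 < δ := (norm_nonneg _).trans_lt hw
  have h0 : ∀ t ∈ Icc (0 : ℝ) 1, γ t - w₀ ≠ 0 := fun t ht =>
    norm_pos_iff.mp (hδ0.trans_le (hδ t ht))
  have h1 : ∀ t ∈ Icc (0 : ℝ) 1, γ t - w₁ ≠ 0 := fun t ht h' => by
    have := hδ t ht
    rw [sub_eq_zero.mp h'] at this
    exact this.not_gt hw
  have hslit : ∀ t ∈ Icc (0 : ℝ) 1, (γ t - w₁) / (γ t - w₀) ∈ Complex.slitPlane := fun t ht => by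
    have : (γ t - w₁) / (γ t - w₀) = 1 + (w₀ - w₁) / (γ t - w₀) := by
      have := h0 t ht
      field_simp
      ring
    rw [this]
    refine Complex.mem_slitPlane_of_norm_lt_one ?_
    rw [norm_div, norm_sub_rev, div_lt_one (norm_pos_iff.mpr (h0 t ht))]
    exact hw.trans_le (hδ t ht)
  have hc : ContinuousOn (fun t => Complex.log ((γ t - w₁) / (γ t - w₀))) (Icc 0 1) :=
    (((h.continuousOn.sub continuousOn_const).div (h.continuousOn.sub continuousOn_const) h0)).clog
      hslit
  have hg : ∀ w, (∀ t ∈ Icc (0 : ℝ) 1, γ t - w ≠ 0) →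
      IntervalIntegrable (fun t => deriv γ t * (γ t - w)⁻¹) volume 0 1 := fun w hw =>
    h.intervalIntegrable ((h.continuousOn.sub continuousOn_const).inv₀ hw)
  obtain ⟨s, hs, -⟩ := h.piecewise
  have key := integral_eq_of_hasDerivAt_off_countable_of_le
    (fun t => Complex.log ((γ t - w₁) / (γ t - w₀)))
    (fun t => deriv γ t * (γ t - w₁)⁻¹ - deriv γ t * (γ t - w₀)⁻¹) zero_le_one
    s.countable_toSet hc (fun t ht => ?_) ((hg w₁ h1).sub (hg w₀ h0))
  · rw [intervalIntegral.integral_sub (hg w₁ h1) (hg w₀ h0), h.closed, sub_self, sub_eq_zero] at key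
    simp only [windingNumber, contourIntegral, smul_eq_mul]
    rw [key]
  · have ht' := Ioo_subset_Icc_self ht.1
    have hd := (hs t ht).hasDerivAt
    have hdiv := ((hd.sub_const w₁).div (hd.sub_const w₀) (h0 t ht')).clog_real (hslit t ht')
    refine hdiv.congr_deriv ?_
    have a0 := h0 t ht'
    have a1 := h1 t ht'
    change (deriv γ t * (γ t - w₀) - (γ t - w₁) * deriv γ t) / (γ t - w₀) ^ 2 /
      ((γ t - w₁) / (γ t - w₀)) = _
    field_simp

theorem IsSimpleClosedCurve.isCompact {γ : ℝ → ℂ} (h : IsSimpleClosedCurve γ) :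
    IsCompact (curveImage γ) := isCompact_Icc.image_of_continuousOn h.continuousOn

theorem exists_ball_windingNumber_eq {γ : ℝ → ℂ} (h : IsSimpleClosedCurve γ) {w : ℂ}
    (hw : w ∉ curveImage γ) :
    ∃ δ > 0, ∀ w' ∈ Metric.ball w δ, w' ∉ curveImage γ ∧ windingNumber γ w' = windingNumber γ w := by
  obtain ⟨δ, hδ, hb⟩ := Metric.isOpen_iff.mp h.isCompact.isClosed.isOpen_compl w hw
  refine ⟨δ, hδ, fun w' hw' => ⟨hb hw', windingNumber_eq_of_norm_lt h (δ := δ) (fun t ht => ?_) ?_⟩⟩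
  · by_contra hlt
    exact hb (a := γ t) (by simpa [dist_eq_norm] using hlt) (mem_image_of_mem γ ht)
  · simpa [dist_eq_norm] using hw'

theorem windingNumber_eq_of_isPreconnected {γ : ℝ → ℂ} (h : IsSimpleClosedCurve γ) {S : Set ℂ}
    (hS : IsPreconnected S) (hd : Disjoint S (curveImage γ)) {w₀ w₁ : ℂ} (h₀ : w₀ ∈ S)
    (h₁ : w₁ ∈ S) : windingNumber γ w₁ = windingNumber γ w₀ := by
  have hopen : ∀ P : ℂ → Prop, IsOpen {w | w ∉ curveImage γ ∧ P (windingNumber γ w)} := fun P => by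
    refine Metric.isOpen_iff.mpr fun w hw => ?_
    obtain ⟨δ, hδ, hb⟩ := exists_ball_windingNumber_eq h hw.1
    exact ⟨δ, hδ, fun w' hw' => ⟨(hb w' hw').1, (hb w' hw').2 ▸ hw.2⟩⟩
  have hcurve : ∀ w ∈ S, w ∉ curveImage γ := fun w hw => disjoint_left.mp hd hw
  refine (hS.subset_left_of_subset_union (hopen (· = windingNumber γ w₀))
    (hopen (· ≠ windingNumber γ w₀)) ?_ (fun w hw => ?_) ⟨w₀, h₀, hcurve _ h₀, rfl⟩ h₁).2
  · exact disjoint_left.mpr fun w hw hw' => hw'.2 hw.2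
  · by_cases hw' : windingNumber γ w = windingNumber γ w₀
    exacts [.inl ⟨hcurve w hw, hw'⟩, .inr ⟨hcurve w hw, hw'⟩]

/-- Far away the integrand has norm at most 1, while winding number one requires an integral of
modulus 2π. -/
theorem exists_windingNumber_ne_one {γ : ℝ → ℂ} (h : IsSimpleClosedCurve γ) :
    ∃ R : ℝ, ∀ w : ℂ, R < ‖w‖ → windingNumber γ w ≠ 1 := by
  obtain ⟨C, hC⟩ := h.bound
  obtain ⟨R, hR⟩ := h.isCompact.isBounded.exists_norm_le
  refine ⟨R + |C| + 1, fun w hw h1 => ?_⟩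
  have hd : ∀ t ∈ Ioc (0 : ℝ) 1, |C| + 1 ≤ ‖γ t - w‖ := fun t ht => by
    have h2 := hR (γ t) (mem_image_of_mem γ (Ioc_subset_Icc_self ht))
    have h3 := norm_sub_norm_le w (γ t)
    rw [norm_sub_rev] at h3
    linarith
  have hb : ‖∫ t in (0 : ℝ)..1, deriv γ t • (γ t - w)⁻¹‖ ≤ 1 * |1 - 0| := by
    refine intervalIntegral.norm_integral_le_of_norm_le_const_ae ?_
    filter_upwards [hC] with t ht ht'
    rw [uIoc_of_le zero_le_one] at ht'
    have h4 := hd t ht'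
    rw [norm_smul, norm_inv, ← div_eq_mul_inv, div_le_one (by linarith [abs_nonneg C])]
    linarith [ht ht', le_abs_self C]
  rw [windingNumber, contourIntegral, inv_mul_eq_one₀ (by simp [Real.pi_ne_zero])] at h1
  rw [← h1] at hb
  simp [abs_of_pos Real.pi_pos] at hb
  linarith [Real.pi_gt_three]

/-- A curve with winding number one around a compact set has winding number one around `0`, when `0` is in a
bounded component of the complement. -/
theorem windingNumber_eq_one_of_isBounded {γ : ℝ → ℂ} {K : Set ℂ} (h : StrictlySurrounds γ K)
    (hK : IsCompact K) (hKn : K.Nonempty) (hz : (0 : ℂ) ∉ K)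
    (hb : Bornology.IsBounded (connectedComponentIn Kᶜ 0)) : windingNumber γ 0 = 1 := by
  have hγ := h.simpleClosed
  set Ω := connectedComponentIn Kᶜ 0
  have hzΩ : 0 ∈ Ω := mem_connectedComponentIn hz
  have hΩo : IsOpen Ω := hK.isClosed.isOpen_compl.connectedComponentIn
  have hΩc : IsPreconnected Ω := isPreconnected_connectedComponentIn
  have hdK : ∀ w ∈ K, w ∉ curveImage γ := fun w hw hw' => disjoint_left.mp h.disjoint hw' hw
  -- If the curve misses Ω, the winding number is constant on Ω with a frontier point added, and
  -- frontier points of Ω lie in K.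
  by_cases hdisj : Disjoint Ω (curveImage γ)
  · have hne : (frontier Ω).Nonempty := by
      rw [nonempty_frontier_iff]
      refine ⟨⟨0, hzΩ⟩, fun hu => ?_⟩
      rw [hu] at hb
      exact NormedSpace.unbounded_univ ℝ ℂ hb
    obtain ⟨w, hw⟩ := hne
    rw [hΩo.frontier_eq] at hw
    have hwc : IsPreconnected (insert w Ω) :=
      hΩc.subset_closure (subset_insert _ _) (insert_subset hw.1 subset_closure)
    have hwK : w ∈ K := by
      by_contra hwK
      refine hw.2 (hwc.subset_connectedComponentIn (mem_insert_of_mem _ hzΩ) ?_ (mem_insert _ _))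
      exact insert_subset hwK (connectedComponentIn_subset _ _)
    rw [windingNumber_eq_of_isPreconnected hγ hwc ?_ (mem_insert w Ω) (mem_insert_of_mem w hzΩ)]
    · exact h.winding w hwK
    · rw [disjoint_insert_left]
      exact ⟨hdK w hwK, hdisj⟩
  -- Otherwise the curve, being connected and disjoint from K, lies in the bounded component Ω. The
  -- radial ray starting at a point of K of largest modulus then avoids the curve and carries
  -- winding number one to infinity.
  · exfalso
    obtain ⟨v, hvΩ, hvγ⟩ := not_disjoint_iff.mp hdisj
    have hγK : curveImage γ ⊆ Kᶜ := disjoint_left.mp h.disjoint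
    have hγc : IsPreconnected (curveImage γ) := isPreconnected_Icc.image γ hγ.continuousOn
    have hγΩ : curveImage γ ⊆ Ω :=
      (hγc.subset_connectedComponentIn hvγ hγK).trans (connectedComponentIn_eq hvΩ).symm.subset
    obtain ⟨w, hwK, hmax⟩ := hK.exists_isMaxOn hKn continuous_norm.continuousOn
    have hw0 : 0 < ‖w‖ := norm_pos_iff.mpr fun h => hz (h ▸ hwK)
    let ray : ℝ → ℂ := fun t => (t : ℂ) * w
    have hrc : Continuous ray := by fun_prop
    have hrn : ∀ t : ℝ, 0 ≤ t → ‖ray t‖ = t * ‖w‖ := fun t ht => by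
      simp [ray, abs_of_nonneg ht]
    have hrK : ray '' Ioi 1 ⊆ Kᶜ := by
      rintro _ ⟨t, ht, rfl⟩ hK'
      have h2 : ‖ray t‖ ≤ ‖w‖ := hmax hK'
      have ht1 : (1 : ℝ) < t := ht
      rw [hrn t (by linarith)] at h2
      nlinarith
    have hrΩ : Disjoint (ray '' Ioi 1) Ω := by
      rw [disjoint_left]
      intro u hu huΩ
      have hsub : ray '' Ioi 1 ⊆ Ω :=
        ((isPreconnected_Ioi.image _ hrc.continuousOn).subset_connectedComponentIn hu hrK).trans
          (connectedComponentIn_eq huΩ).symm.subset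
      obtain ⟨R, hR⟩ := (hb.subset hsub).exists_norm_le
      have ht : 1 < |R| / ‖w‖ + 2 := by linarith [show 0 ≤ |R| / ‖w‖ by positivity]
      have h2 := hR _ (mem_image_of_mem ray ht)
      rw [hrn _ (by positivity), add_mul, div_mul_cancel₀ _ hw0.ne'] at h2
      linarith [le_abs_self R]
    have hrγ : Disjoint (ray '' Ici 1) (curveImage γ) := by
      rw [disjoint_left]
      rintro _ ⟨t, ht, rfl⟩ hu
      rcases (mem_Ici.mp ht).eq_or_lt with rfl | ht
      · exact hdK w hwK (by simpa [ray] using hu)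
      · exact disjoint_left.mp hrΩ (mem_image_of_mem ray ht) (hγΩ hu)
    obtain ⟨R, hR⟩ := exists_windingNumber_ne_one hγ
    have ht : (1 : ℝ) ≤ |R| / ‖w‖ + 1 := by linarith [show 0 ≤ |R| / ‖w‖ by positivity]
    refine hR (ray (|R| / ‖w‖ + 1)) ?_ ?_
    · rw [hrn _ (by positivity), add_mul, div_mul_cancel₀ _ hw0.ne']
      linarith [le_abs_self R]
    · rw [windingNumber_eq_of_isPreconnected hγ (isPreconnected_Ici.image ray hrc.continuousOn) hrγ
        (mem_image_of_mem ray self_mem_Ici) (mem_image_of_mem ray ht)]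
      simpa [ray] using h.winding w hwK

/-- The spectrum of a symbol with a star logarithm does not separate `0` from infinity. -/
theorem IsStarLog.unbounded {a b : SymbolFn} (h : IsStarLog a b) :
    (0 : ℂ) ∉ spectrum ℂ (laurentOp a) ∧
      ¬ Bornology.IsBounded (connectedComponentIn (spectrum ℂ (laurentOp a))ᶜ 0) := by
  obtain ⟨U, f, hf, -, -, γ, hγ, hγU, hU, -⟩ := h
  -- The exponential never vanishes, so no branch of the logarithm is defined at 0 and the curve
  -- cannot wind around it.
  have h0 : (0 : ℂ) ∉ U := fun h => Complex.exp_ne_zero _ (hf 0 h)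
  have h0γ : (0 : ℂ) ∉ curveImage γ := fun h => h0 (hγU h)
  have h0w : windingNumber γ 0 = 0 := by
    by_contra hne
    exact h0 (hU 0 h0γ hne)
  have h0K : (0 : ℂ) ∉ spectrum ℂ (laurentOp a) := fun hK => by
    simp [hγ.winding 0 hK] at h0w
  have : Nontrivial (ell2 ℤ) := ⟨lp.single 2 0 1, 0, fun h => by
    simpa using congrArg (fun x : ell2 ℤ => x 0) h⟩
  refine ⟨h0K, fun hb => ?_⟩
  have := windingNumber_eq_one_of_isBounded hγ (spectrum.isCompact _) (spectrum.nonempty _) h0K hb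
  simp [this] at h0w

end

section
open Set

/-! ## Triangular operators and their inverses -/

/-- The operators on `ℓ²(ℤ)` whose matrix is supported on the preorder `R`. -/
def triangular (R : ℤ → ℤ → Prop) [IsPreorder ℤ R] : Subalgebra ℂ (ell2 ℤ →L[ℂ] ell2 ℤ) where
  carrier := {A | ∀ j k, ¬ R j k → entry A j k = 0}
  mul_mem' {A B} hA hB j k hjk := by
    refine ((entry_mul A B j k).unique ?_)
    convert hasSum_zero (α := ℂ) (β := ℤ) with l
    by_cases h : R j l
    · rw [hB l k fun h' => hjk (trans_of R h h'), mul_zero]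
    · rw [hA j l h, zero_mul]
  add_mem' {A B} hA hB j k hjk := by rw [entry_add, hA j k hjk, hB j k hjk, add_zero]
  algebraMap_mem' c j k hjk := by
    rw [Algebra.algebraMap_eq_smul_one, entry_smul, entry_one,
      if_neg (by rintro rfl; exact hjk (refl_of R j)), mul_zero]

theorem mem_triangular {R : ℤ → ℤ → Prop} [IsPreorder ℤ R] {A : ell2 ℤ →L[ℂ] ell2 ℤ} :
    A ∈ triangular R ↔ ∀ j k, ¬ R j k → entry A j k = 0 := Iff.rfl

theorem isClosed_triangular (R : ℤ → ℤ → Prop) [IsPreorder ℤ R] :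
    IsClosed (triangular R : Set (ell2 ℤ →L[ℂ] ell2 ℤ)) := by
  have : (triangular R : Set (ell2 ℤ →L[ℂ] ell2 ℤ)) =
      ⋂ (j : ℤ) (k : ℤ) (_ : ¬ R j k), {A | entry A j k = 0} := by
    ext A; simp [mem_triangular]
  rw [this]
  exact isClosed_iInter fun j => isClosed_iInter fun k => isClosed_iInter fun _ =>
    isClosed_eq (continuous_entry j k) continuous_const

/-- Passing to a closed subalgebra can add to the spectrum only bounded components of its
complement; here 0 lies in an unbounded one. -/
theorem exists_inverse_mem_triangular {R : ℤ → ℤ → Prop} [IsPreorder ℤ R]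
    {A : ell2 ℤ →L[ℂ] ell2 ℤ} (hA : A ∈ triangular R)
    (hb : ¬ Bornology.IsBounded (connectedComponentIn (spectrum ℂ A)ᶜ 0)) :
    ∃ B ∈ triangular R, A * B = 1 ∧ B * A = 1 := by
  have := isClosed_triangular R
  have h : (0 : ℂ) ∉ spectrum ℂ (⟨A, hA⟩ : triangular R) := fun h =>
    hb (Subalgebra.spectrum_isBounded_connectedComponentIn (triangular R) ⟨A, hA⟩ h)
  rw [spectrum.zero_notMem_iff] at h
  obtain ⟨u, hu⟩ := h
  refine ⟨(u⁻¹ : (triangular R)ˣ), (u⁻¹ : (triangular R)ˣ).1.2, ?_, ?_⟩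
  · have := congrArg Subtype.val u.mul_inv
    rwa [hu] at this
  · have := congrArg Subtype.val u.inv_mul
    rwa [hu] at this

/-- Dominated convergence as s ↓ 1. The sum bounds the change of a decaying matrix under conjugation
by weights of growth rate s. -/
theorem exists_weight {C r : ℝ} (hC : 0 ≤ C) (h0 : 0 < r) (h1 : r < 1) {ε : ℝ} (hε : 0 < ε) :
    ∃ s : ℝ, 1 < s ∧ Summable (fun d : ℤ => C * r ^ d.natAbs * (s ^ d.natAbs - 1)) ∧
      ∑' d : ℤ, C * r ^ d.natAbs * (s ^ d.natAbs - 1) < ε := by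
  obtain ⟨s₀, hs₀, hs₀'⟩ := exists_between ((one_lt_inv₀ h0).mpr h1)
  have hq : r * s₀ < 1 := by
    rwa [← lt_inv_mul_iff₀ h0, mul_one]
  have hbs := (summable_pow_natAbs (by positivity) hq).mul_left C
  have hev : ∀ᶠ s in nhdsWithin (1 : ℝ) (Ioi 1), 1 < s ∧ s < s₀ := by
    filter_upwards [Ioo_mem_nhdsGT hs₀] with s hs using hs
  have hbd : ∀ s, 1 < s → s < s₀ → ∀ d : ℤ,
      ‖C * r ^ d.natAbs * (s ^ d.natAbs - 1)‖ ≤ C * (r * s₀) ^ d.natAbs := fun s hs hs' d => by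
    have h2 : 1 ≤ s ^ d.natAbs := one_le_pow₀ hs.le
    rw [Real.norm_of_nonneg (mul_nonneg (by positivity) (by linarith)), mul_pow, mul_assoc]
    gcongr
    have : s ^ d.natAbs ≤ s₀ ^ d.natAbs := by gcongr
    linarith
  have ht := tendsto_tsum_of_dominated_convergence (𝓕 := nhdsWithin (1 : ℝ) (Ioi 1))
    (f := fun s (d : ℤ) => C * r ^ d.natAbs * (s ^ d.natAbs - 1)) (g := fun _ => 0) hbs
    (fun d => by
      have : Continuous fun s : ℝ => C * r ^ d.natAbs * (s ^ d.natAbs - 1) := by fun_prop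
      have := (this.tendsto 1).mono_left (nhdsWithin_le_nhds (s := Ioi 1))
      simpa using this)
    (by filter_upwards [hev] with s hs using hbd s hs.1 hs.2)
  rw [tsum_zero] at ht
  obtain ⟨s, hs, hs'⟩ := (hev.and (ht.eventually (gt_mem_nhds hε))).exists
  exact ⟨s, hs.1, .of_norm_bounded hbs (hbd s hs.1 hs.2), hs'⟩

theorem abs_pow_div_pow_sub_one_le {s : ℝ} (hs : 1 < s) {p q d : ℕ} (hp : p ≤ q + d)
    (hq : q ≤ p + d) : |s ^ p / s ^ q - 1| ≤ s ^ d - 1 := by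
  have hs0 : 0 < s := by linarith
  have h1 : s ^ p ≤ s ^ q * s ^ d := by rw [← pow_add]; gcongr; exact hs.le
  have h2 : s ^ q ≤ s ^ p * s ^ d := by rw [← pow_add]; gcongr; exact hs.le
  have h3 : 1 ≤ s ^ d := one_le_pow₀ hs.le
  have hp0 := pow_pos hs0 p
  have hq0 := pow_pos hs0 q
  have h4 : s ^ p / s ^ q ≤ s ^ d := by rw [div_le_iff₀ hq0]; linarith
  have h5 : 1 ≤ s ^ p / s ^ q * s ^ d := by
    rw [div_mul_eq_mul_div, le_div_iff₀ hq0]; linarith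
  rw [abs_le]
  constructor
  · nlinarith [div_pos hp0 hq0]
  · linarith

/-- The inverse of a matrix decaying exponentially off the diagonal has the same property. -/
theorem decayMatrix_inverse {A B : ell2 ℤ →L[ℂ] ell2 ℤ} (hA : DecayMatrix (entry A))
    (hAB : A * B = 1) (hBA : B * A = 1) : DecayMatrix (entry B) := by
  obtain ⟨C, r, hC, h0, h1, h⟩ := hA
  -- This ε gives ‖B‖ ‖E‖ ≤ 1/2 for the perturbation E below; the added 1 keeps the denominator
  -- positive.
  obtain ⟨s, hs, hsum, hlt⟩ := exists_weight hC h0 h1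
    (ε := 1 / (2 * (‖B‖ + 1))) (by positivity)
  have hs0 : 0 < s := by linarith
  have hη : ‖B‖ * (1 / (2 * (‖B‖ + 1))) ≤ 1 / 2 := by
    rw [mul_one_div, div_le_div_iff₀ (by positivity) (by positivity)]; linarith [norm_nonneg B]
  refine ⟨2 * ‖B‖, s⁻¹, by positivity, by positivity, inv_lt_one_of_one_lt₀ hs, fun i k => ?_⟩
  set n := (i - k).natAbs
  -- Capping the exponent at n keeps the weight bounded, so the weighted column of B stays in ℓ²; at
  -- l = i, where the estimate is read off, nothing is lost.
  let w : ℤ → ℝ := fun l => s ^ min (l - k).natAbs n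
  have hw0 : ∀ l, 0 < w l := fun l => by positivity
  have hwn : ∀ l, w l ≤ s ^ n := fun l => pow_le_pow_right₀ hs.le (min_le_right _ _)
  -- A + E is A conjugated by the weight. As w k = 1, the weighted column u of B satisfies (A + E) u
  -- = e, that is u = b - B E u, whence ‖u‖ ≤ 2 ‖B‖.
  obtain ⟨E, hE, hEe⟩ := exists_op_of_diagonal_bound
    (M := fun j l => entry A j l * ((w j / w l - 1 : ℝ) : ℂ)) hsum
    (fun d => mul_nonneg (by positivity) (by linarith [one_le_pow₀ hs.le (n := d.natAbs)]))
    (fun j l => by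
      rw [norm_mul, Complex.norm_real, Real.norm_eq_abs]
      gcongr
      · exact h j l
      · exact abs_pow_div_pow_sub_one_le hs (by omega) (by omega))
    Function.injective_id Function.injective_id
  set e : ell2 ℤ := lp.single 2 k (1 : ℂ)
  have he : ‖e‖ = 1 := by rw [lp.norm_single (by norm_num)]; simp
  set b : ell2 ℤ := B e
  have hb : A b = e := congrArg (fun T : ell2 ℤ →L[ℂ] ell2 ℤ => T e) hAB
  have hu : Memℓp (fun l => (w l : ℂ) * b l) 2 := by
    refine memℓp_gen (Summable.of_nonneg_of_le (fun _ => by positivity) (fun l => ?_)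
      (((lp.memℓp b).summable (by norm_num)).mul_left ((s ^ n) ^ (2 : ENNReal).toReal)))
    rw [norm_mul, Complex.norm_real, Real.norm_of_nonneg (hw0 l).le,
      Real.mul_rpow (hw0 l).le (norm_nonneg _)]
    gcongr
    exact hwn l
  let u : ell2 ℤ := ⟨_, hu⟩
  have hul : ∀ l, u l = (w l : ℂ) * b l := fun l => rfl
  have hAu : A u + E u = e := by
    ext j
    have h2 := (hasSum_apply A u j).add (hasSum_apply E u j)
    have h3 := (hasSum_apply A b j).mul_left (w j : ℂ)
    have h4 : (A u + E u) j = (w j : ℂ) * (A b) j := by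
      refine h2.unique ?_
      refine (congrArg (HasSum · _) (funext fun l => ?_)).mpr h3
      rw [hEe, hul]
      have : (w l : ℂ) ≠ 0 := by exact_mod_cast (hw0 l).ne'
      push_cast
      simp only [id]
      field_simp
      ring
    rw [h4, hb]
    by_cases hjk : j = k
    · subst hjk; simp [w]
    · simp [e, hjk]
  have hu' : u = b - B (E u) := by
    have h5 := congrArg B hAu
    rw [map_add, show B (A u) = u from congrArg (fun T : ell2 ℤ →L[ℂ] ell2 ℤ => T u) hBA] at h5
    exact eq_sub_of_add_eq h5
  have hun : ‖u‖ ≤ ‖B‖ + 1 / 2 * ‖u‖ := by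
    calc ‖u‖ = ‖b - B (E u)‖ := by rw [← hu']
      _ ≤ ‖b‖ + ‖B (E u)‖ := norm_sub_le _ _
      _ ≤ ‖B‖ * ‖e‖ + ‖B‖ * (1 / (2 * (‖B‖ + 1)) * ‖u‖) := by
        gcongr
        · exact B.le_opNorm e
        · exact (B.le_opNorm _).trans (by gcongr; exact E.le_of_opNorm_le (hE.trans hlt.le) u)
      _ ≤ _ := by
        rw [he, mul_one, ← mul_assoc]; gcongr
  have h6 : ‖u i‖ ≤ ‖u‖ := lp.norm_apply_le_norm (by norm_num) u i
  rw [hul, norm_mul, Complex.norm_real, Real.norm_of_nonneg (hw0 i).le] at h6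
  have hwi : w i = s ^ n := by simp [w, n]
  rw [hwi] at h6
  change ‖b i‖ ≤ _
  rw [inv_pow, ← div_eq_mul_inv, le_div_iff₀ (by positivity)]
  linarith

theorem CoeffDecay.decayMatrix_entry {a : SymbolFn} (ha : CoeffDecay a) :
    DecayMatrix (entry (laurentOp a)) := by
  have : entry (laurentOp a) = laurentEntry a := by ext j k; exact ha.entry_laurentOp j k
  rw [this]; exact ha.decayMatrix

theorem sameSymbol_one_iff {a b : SymbolFn} (ha : CoeffDecay a) (hb : CoeffDecay b) :
    SameSymbol (starMul a b) oneSymbol ↔ laurentOp a * laurentOp b = 1 := by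
  rw [← ha.laurentOp_starMul hb]
  constructor
  · exact fun h => entry_ext fun j k => by
      rw [(ha.starMul hb).entry_laurentOp, h, laurentEntry_oneSymbol, entry_one]
  · exact fun h j k => by
      rw [← (ha.starMul hb).entry_laurentOp, h, laurentEntry_oneSymbol, entry_one]

/-- The triangular inverse decays, hence comes from a symbol in V. `starInv a` is only a chosen
representative, but inverses are unique, so it has the same operator. -/
theorem HasStarLogInV.starInv {a : SymbolFn} (ha : MemV a) (hlog : HasStarLogInV a)
    {R : ℤ → ℤ → Prop} [IsPreorder ℤ R] (hR : laurentOp a ∈ triangular R) :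
    StarInvertible a ∧ CoeffDecay (starInv a) ∧ laurentOp (starInv a) ∈ triangular R ∧
      laurentOp a * laurentOp (starInv a) = 1 ∧ laurentOp (starInv a) * laurentOp a = 1 := by
  obtain ⟨b, -, hb⟩ := hlog
  obtain ⟨B, hB, hAB, hBA⟩ := exists_inverse_mem_triangular hR hb.unbounded.2
  have hd := decayMatrix_inverse ha.coeffDecay.decayMatrix_entry hAB hBA
  have hc := hd.memV_symbolOfMatrix
  have hcB : laurentOp (symbolOfMatrix (entry B)) = B := entry_ext fun j k => by
    rw [hc.coeffDecay.entry_laurentOp, hd.laurentEntry_symbolOfMatrix]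
  have hinv : StarInvertible a := ⟨_, hc,
    (sameSymbol_one_iff ha.coeffDecay hc.coeffDecay).mpr (by rwa [hcB]),
    (sameSymbol_one_iff hc.coeffDecay ha.coeffDecay).mpr (by rwa [hcB])⟩
  have hspec : IsStarInverse a (StarToeplitz.starInv a) := by
    rw [StarToeplitz.starInv, dif_pos hinv]; exact hinv.choose_spec
  obtain ⟨h1, h2, h3⟩ := hspec
  have h2' := (sameSymbol_one_iff ha.coeffDecay h1.coeffDecay).mp h2
  have h3' := (sameSymbol_one_iff h1.coeffDecay ha.coeffDecay).mp h3
  exact ⟨hinv, h1.coeffDecay, left_inv_eq_right_inv h3' hAB ▸ hB, h2', h3'⟩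

end

section
open Filter Topology

/-! ## Fredholm determinants of rapidly decaying matrices -/

/-- Multilinear expansion in the rows: S records the rows taken from M. The others are rows of the
identity, so each term is block triangular. -/
theorem det_one_add_eq_sum {n R : Type*} [Fintype n] [DecidableEq n] [CommRing R]
    (M : Matrix n n R) :
    (1 + M).det = ∑ S : Finset n, (M.submatrix ((↑) : S → n) (↑)).det := by
  rw [add_comm]
  refine (MultilinearMap.map_add_univ
    (Matrix.detRowAlternating (R := R) (n := n)).toMultilinearMap M (1 : Matrix n n R)).trans ?_
  refine Finset.sum_congr rfl fun S _ => ?_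
  let P : Matrix n n R := Matrix.of fun i j => if i ∈ S then M i j else (1 : Matrix n n R) i j
  have hPij : ∀ i j, P i j = if i ∈ S then M i j else (1 : Matrix n n R) i j := fun _ _ => rfl
  have hP : P.det = (P.toSquareBlockProp (· ∈ S)).det * (P.toSquareBlockProp (¬ · ∈ S)).det := by
    convert Matrix.twoBlockTriangular_det P (· ∈ S) fun i hi j hj => ?_
    rw [hPij, if_neg hi, Matrix.one_apply_ne]
    rintro rfl; exact hi hj
  have hS : (fun i => S.piecewise (fun i => M i) (fun i => (1 : Matrix n n R) i) i) = P := by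
    ext i j
    by_cases hi : i ∈ S <;> simp [P, hi]
  refine (congrArg Matrix.det hS).trans (hP.trans ?_)
  have h1 : P.toSquareBlockProp (¬ · ∈ S) = 1 := by
    ext i j
    rw [Matrix.toSquareBlockProp_def, Matrix.of_apply, hPij, if_neg i.2,
      Matrix.one_apply, Matrix.one_apply]
    simp only [Subtype.ext_iff]
  rw [h1, Matrix.det_one, mul_one]
  congr 1
  ext i j
  rw [Matrix.toSquareBlockProp_def, Matrix.of_apply, hPij, if_pos i.2]
  rfl

/-- Jacobi's identity for complementary minors. -/
theorem det_mul_det_toBlocks₁₁ {m n R : Type*} [Fintype m] [DecidableEq m] [Fintype n]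
    [DecidableEq n] [CommRing R] {M X : Matrix (m ⊕ n) (m ⊕ n) R} (h : M * X = 1) :
    M.det * X.toBlocks₁₁.det = M.toBlocks₂₂.det := by
  have h1 : M * Matrix.fromBlocks X.toBlocks₁₁ 0 X.toBlocks₂₁ 1 =
      Matrix.fromBlocks 1 M.toBlocks₁₂ 0 M.toBlocks₂₂ := by
    rw [← Matrix.fromBlocks_toBlocks M, ← Matrix.fromBlocks_toBlocks X, Matrix.fromBlocks_multiply,
      ← Matrix.fromBlocks_one, Matrix.fromBlocks_inj] at h
    conv_lhs => rw [← Matrix.fromBlocks_toBlocks M]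
    rw [Matrix.fromBlocks_multiply, h.1, h.2.2.1]
    simp
  have h2 := congrArg Matrix.det h1
  rwa [Matrix.det_mul, Matrix.det_fromBlocks_zero₁₂, Matrix.det_fromBlocks_zero₂₁, Matrix.det_one,
    Matrix.det_one, mul_one, one_mul] at h2

theorem factorial_card_le_prod (S : Finset ℕ) : (S.card.factorial : ℕ) ≤ ∏ j ∈ S, (j + 1) := by
  induction S using Finset.induction_on_max with
  | empty => simp
  | insert a S ha ih =>
    have haS : a ∉ S := fun h => (ha a h).false
    rw [Finset.card_insert_of_notMem haS, Finset.prod_insert haS, Nat.factorial_succ]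
    have : S.card ≤ a := by
      simpa using Finset.card_le_card (t := Finset.range a) fun x hx => Finset.mem_range.mpr (ha x hx)
    gcongr

/-- The principal submatrix of `K` with rows and columns in `S`. -/
def principal (K : ℕ → ℕ → ℂ) (S : Finset ℕ) : Matrix S S ℂ := Matrix.of fun i j => K i j

/-- All permutations in the Leibniz formula obey the same bound, because ∏ r^{σ i} = ∏ r^i.
Absorbing their number |S|! into ∏ (j + 1) leaves a product over S, which can be summed over all
finite S. -/
theorem norm_det_principal_le {K : ℕ → ℕ → ℂ} {C r : ℝ} (hC : 0 ≤ C) (h0 : 0 < r)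
    (hK : ∀ j k, ‖K j k‖ ≤ C * r ^ (j + k)) (S : Finset ℕ) :
    ‖(principal K S).det‖ ≤ ∏ j ∈ S, C * ((j + 1) * (r ^ 2) ^ j) := by
  rw [Matrix.det_apply]
  calc _ ≤ ∑ σ : Equiv.Perm S, ∏ j : S, C * (r ^ 2) ^ (j : ℕ) := by
        refine norm_sum_le_of_le _ fun σ _ => ?_
        have hsign : ‖Equiv.Perm.sign σ • ∏ i, principal K S (σ i) i‖ =
            ‖∏ i, principal K S (σ i) i‖ := by
          rcases Int.units_eq_one_or (Equiv.Perm.sign σ) with h | h <;> rw [h] <;> simp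
        rw [hsign, norm_prod]
        calc _ ≤ ∏ i : S, (C * r ^ (i : ℕ)) * r ^ (σ i : ℕ) :=
              Finset.prod_le_prod (fun _ _ => norm_nonneg _) fun i _ =>
                (hK _ _).trans_eq (by rw [pow_add]; ring)
          _ = ∏ i : S, (C * r ^ (i : ℕ)) * r ^ (i : ℕ) := by
              rw [Finset.prod_mul_distrib, Equiv.prod_comp σ fun i : S => r ^ (i : ℕ),
                ← Finset.prod_mul_distrib]
          _ = _ := Finset.prod_congr rfl fun i _ => by ring
    _ = S.card.factorial * ∏ j ∈ S, C * (r ^ 2) ^ j := by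
        rw [Finset.sum_const, Finset.card_univ, Fintype.card_perm, Fintype.card_coe, nsmul_eq_mul,
          Finset.prod_coe_sort S fun j => C * (r ^ 2) ^ j]
    _ ≤ (∏ j ∈ S, ((j : ℝ) + 1)) * ∏ j ∈ S, C * (r ^ 2) ^ j := by
        gcongr
        exact_mod_cast factorial_card_le_prod S
    _ = _ := by
        rw [← Finset.prod_mul_distrib]
        exact Finset.prod_congr rfl fun j _ => by ring

theorem summable_minor_bound (C : ℝ) {r : ℝ} (h0 : 0 < r) (h1 : r < 1) (hC : 0 ≤ C) :
    Summable fun S : Finset ℕ => ∏ j ∈ S, C * (((j : ℝ) + 1) * (r ^ 2) ^ j) := by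
  have hr : ‖r ^ 2‖ < 1 := by
    rw [Real.norm_of_nonneg (by positivity)]; exact pow_lt_one₀ h0.le h1 two_ne_zero
  have h2 := (summable_pow_mul_geometric_of_norm_lt_one 1 hr).add
    (summable_geometric_of_norm_lt_one hr)
  refine summable_finsetProd_of_summable_nonneg (fun j => by positivity) (.mul_left C ?_)
  simpa [add_mul] using h2

theorem tendsto_det_one_add {K : ℕ → ℕ → ℂ} (hs : Summable fun S => (principal K S).det) :
    Tendsto (fun N : ℕ => (1 + Matrix.of fun i j : Fin N => K i j).det) atTop
      (𝓝 (∑' S, (principal K S).det)) := by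
  have h1 : Tendsto (fun N => (Finset.range N).powerset) atTop atTop := by
    refine tendsto_atTop_finset_of_monotone
      (fun a b h => Finset.powerset_mono.mpr (Finset.range_mono h)) fun S => ?_
    obtain ⟨N, hN⟩ := Finset.exists_nat_subset_range S
    exact ⟨N, Finset.mem_powerset.mpr hN⟩
  refine (hs.hasSum.comp h1).congr fun N => ?_
  rw [det_one_add_eq_sum]
  symm
  refine Finset.sum_bij (fun S _ => S.map Fin.valEmbedding) (fun S _ => ?_) (fun S _ T _ h => ?_)
    (fun S hS => ?_) (fun S _ => ?_)
  · rw [Finset.mem_powerset]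
    intro x hx
    obtain ⟨i, -, rfl⟩ := Finset.mem_map.mp hx
    exact Finset.mem_range.mpr i.2
  · exact Finset.map_injective _ h
  · rw [Finset.mem_powerset] at hS
    refine ⟨S.attachFin fun x hx => Finset.mem_range.mp (hS hx), Finset.mem_univ _, ?_⟩
    ext x
    simp only [Finset.mem_map, Finset.mem_attachFin, Fin.valEmbedding_apply]
    exact ⟨by rintro ⟨i, hi, rfl⟩; exact hi,
      fun hx => ⟨⟨x, Finset.mem_range.mp (hS hx)⟩, hx, rfl⟩⟩
  · let e : S ≃ S.map Fin.valEmbedding := Equiv.ofBijective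
      (fun i => ⟨i, Finset.mem_map_of_mem Fin.valEmbedding i.2⟩)
      ⟨fun i j h => Subtype.ext (Fin.ext (congrArg Subtype.val h)), fun ⟨x, hx⟩ => by
        obtain ⟨i, hi, rfl⟩ := Finset.mem_map.mp hx
        exact ⟨⟨i, hi⟩, rfl⟩⟩
    rw [← Matrix.det_submatrix_equiv_self e]
    rfl

/-- Dominated convergence over S: the shifted entries tend to 0, and only the empty minor, equal to
1, survives. -/
theorem tendsto_tsum_det_principal_shift {K : ℕ → ℕ → ℂ} {C r : ℝ} (hC : 0 ≤ C) (h0 : 0 < r)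
    (h1 : r < 1) (hK : ∀ j k, ‖K j k‖ ≤ C * r ^ (j + k)) :
    Tendsto (fun n => ∑' S, (principal (fun j k => K (n + j) (n + k)) S).det) atTop (𝓝 1) := by
  have hlim : ∑' S : Finset ℕ, (0 : Matrix S S ℂ).det = 1 := by
    rw [tsum_eq_single ∅ fun S hS => ?_]
    · exact Matrix.det_isEmpty
    · have : Nonempty S := (Finset.nonempty_iff_ne_empty.mpr hS).to_subtype
      exact Matrix.det_zero
  rw [← hlim]
  refine tendsto_tsum_of_dominated_convergence (summable_minor_bound C h0 h1 hC) (fun S => ?_)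
    (.of_forall fun n S => norm_det_principal_le hC h0 (fun j k => (hK _ _).trans ?_) S)
  · refine ((continuous_id.matrix_det (n := S)).tendsto (0 : Matrix S S ℂ)).comp ?_
    refine tendsto_pi_nhds.mpr fun i => tendsto_pi_nhds.mpr fun j => ?_
    refine squeeze_zero_norm (a := fun n => C * r ^ n) (fun n => (hK _ _).trans ?_) ?_
    · gcongr ?_ * ?_
      exact pow_le_pow_of_le_one h0.le h1.le (by omega)
    · simpa using (tendsto_pow_atTop_nhds_zero_of_lt_one h0.le h1).const_mul C
  · gcongr ?_ * ?_
    exact pow_le_pow_of_le_one h0.le h1.le (by omega)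

end

/-! ### Jacobi's identity and trace class for operators with rapidly decaying entries -/

section
open Filter Topology

theorem fredholmDet_one_add (K : ell2 ℕ →L[ℂ] ell2 ℕ) :
    fredholmDet (1 + K) = ∑' S, (principal (entry K) S).det := by
  rw [fredholmDet, add_sub_cancel_left]
  rfl

/-- The leading `n × n` block of the matrix of an operator. -/
noncomputable def leading (n : ℕ) (A : ell2 ℕ →L[ℂ] ell2 ℕ) : Matrix (Fin n) (Fin n) ℂ :=
  Matrix.of fun i j => entry A i j

theorem exists_truncation {K : ell2 ℕ →L[ℂ] ell2 ℕ} {C r : ℝ} (hC : 0 ≤ C) (h0 : 0 < r)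
    (h1 : r < 1) (hK : ∀ j k, ‖entry K j k‖ ≤ C * r ^ (j + k)) :
    ∃ L : ℕ → ell2 ℕ →L[ℂ] ell2 ℕ, Tendsto L atTop (𝓝 K) ∧
      ∀ N j k, entry (L N) j k = if j < N ∧ k < N then entry K j k else 0 := by
  -- Write r^(j+k) as q^(j+k) twice: outside the N × N corner one copy is at most q^N, and the other
  -- is left for Schur's test.
  obtain ⟨q, hq0, hq⟩ : ∃ q : ℝ, 0 < q ∧ q ^ 2 = r := ⟨√r, Real.sqrt_pos.mpr h0, Real.sq_sqrt h0.le⟩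
  have hq1 : q < 1 := by nlinarith
  have hsum := summable_geometric_of_lt_one hq0.le hq1
  have hD : ∀ N, ∃ D : ell2 ℕ →L[ℂ] ell2 ℕ, ‖D‖ ≤ C * q ^ N * (1 - q)⁻¹ ∧
      ∀ j k, entry D j k = if j < N ∧ k < N then 0 else entry K j k := fun N => by
    have hb : ∀ j k, ‖if j < N ∧ k < N then 0 else entry K j k‖ ≤ C * q ^ N * q ^ (j + k) :=
      fun j k => by
        split_ifs with h
        · rw [norm_zero]; positivity
        · refine (hK j k).trans ?_
          rw [← hq, ← pow_mul, two_mul, pow_add, ← mul_assoc]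
          gcongr C * ?_ * _
          exact pow_le_pow_of_le_one hq0.le hq1.le (by omega)
    have hrow : ∀ w : ℕ → ℂ, (∃ i, ∀ k, ‖w k‖ ≤ C * q ^ N * q ^ (i + k)) →
        Summable (fun k => ‖w k‖) ∧ ∑' k, ‖w k‖ ≤ C * q ^ N * (1 - q)⁻¹ := fun w ⟨i, hw⟩ => by
      have hw' : ∀ k, ‖w k‖ ≤ C * q ^ N * q ^ k := fun k => (hw k).trans (by
        gcongr _ * ?_
        exact pow_le_pow_of_le_one hq0.le hq1.le (by omega))
      have hs := Summable.of_nonneg_of_le (fun _ => norm_nonneg _) hw' (hsum.mul_left _)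
      refine ⟨hs, (hs.tsum_le_tsum hw' (hsum.mul_left _)).trans_eq ?_⟩
      rw [tsum_mul_left, tsum_geometric_of_lt_one hq0.le hq1]
    have hr := fun j => hrow (fun k => if j < N ∧ k < N then 0 else entry K j k) ⟨j, hb j⟩
    have hc := fun k => hrow (fun j => if j < N ∧ k < N then 0 else entry K j k)
      ⟨k, fun j => add_comm j k ▸ hb j k⟩
    exact schur_test _ _ (mul_nonneg (by positivity) (inv_nonneg.mpr (by linarith)))
      (fun j => (hr j).1) (fun j => (hr j).2) (fun k => (hc k).1) (fun k => (hc k).2)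
  choose D hDn hDe using hD
  have hD0 : Tendsto D atTop (𝓝 0) := by
    refine squeeze_zero_norm hDn ?_
    simpa using ((tendsto_pow_atTop_nhds_zero_of_lt_one hq0.le hq1).const_mul C).mul_const (1 - q)⁻¹
  refine ⟨fun N => K - D N, by simpa using hD0.const_sub K, fun N j k => ?_⟩
  rw [entry_sub, hDe]
  split_ifs <;> simp

/-- Jacobi's identity for an operator of the form `1 + K` and its inverse. -/
theorem fredholmDet_mul_det_leading_inverse {K X : ell2 ℕ →L[ℂ] ell2 ℕ} {C r : ℝ} (hC : 0 ≤ C)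
    (h0 : 0 < r) (h1 : r < 1) (hK : ∀ j k, ‖entry K j k‖ ≤ C * r ^ (j + k))
    (hYX : (1 + K) * X = 1) (hXY : X * (1 + K) = 1) (n : ℕ) :
    fredholmDet (1 + K) * (leading n X).det =
      ∑' S, (principal (fun j k => entry K (n + j) (n + k)) S).det := by
  -- Truncations converge in norm and inversion is continuous, so the leading blocks of the inverses
  -- converge too.
  obtain ⟨L, hL, hLe⟩ := exists_truncation hC h0 h1 hK
  let Y : (ell2 ℕ →L[ℂ] ell2 ℕ)ˣ := ⟨1 + K, X, hYX, hXY⟩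
  have hY : Tendsto (fun N => 1 + L N) atTop (𝓝 (Y : ell2 ℕ →L[ℂ] ell2 ℕ)) := hL.const_add 1
  have hinv : Tendsto (fun N => Ring.inverse (1 + L N)) atTop (𝓝 X) := by
    have := (NormedRing.inverse_continuousAt Y).tendsto.comp hY
    rwa [Ring.inverse_unit] at this
  have hunit : ∀ᶠ N in atTop, IsUnit (1 + L N) := 
    hY.eventually (Units.isOpen.mem_nhds Y.isUnit)
  have hsK := Summable.of_norm_bounded (summable_minor_bound C h0 h1 hC)
    (norm_det_principal_le hC h0 hK)
  have hsK' := Summable.of_norm_bounded (summable_minor_bound C h0 h1 hC)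
    (norm_det_principal_le (K := fun j k => entry K (n + j) (n + k)) hC h0 fun j k =>
      (hK _ _).trans (by
        gcongr ?_ * ?_
        exact pow_le_pow_of_le_one h0.le h1.le (by omega)))
  have hlead : Tendsto (fun N => (leading n (Ring.inverse (1 + L N))).det) atTop
      (𝓝 (leading n X).det) := by
    have hc : Continuous fun A => (leading n A).det :=
      Continuous.matrix_det (continuous_pi fun i : Fin n => continuous_pi fun j : Fin n =>
        continuous_entry (i : ℕ) (j : ℕ))
    exact (hc.tendsto X).comp hinv
  have hadd : Tendsto (fun m : ℕ => n + m) atTop atTop := tendsto_add_atTop_nat n |>.congr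
    fun m => add_comm m n
  rw [fredholmDet_one_add]
  refine tendsto_nhds_unique ((((tendsto_det_one_add hsK).mul hlead).comp hadd).congr' ?_)
    (tendsto_det_one_add hsK')
  filter_upwards [hadd.eventually hunit] with m hm
  have hmul := Ring.mul_inverse_cancel _ hm
  set Z := Ring.inverse (1 + L (n + m))
  -- `L (n + m)` vanishes outside its corner, so the corner of its product with `Z` is a product of
  -- finite matrices.
  have hfin : (1 + Matrix.of fun i j : Fin (n + m) => entry K i j) * leading (n + m) Z = 1 := by
    ext i j
    have h2 := congrArg (fun T => entry T (i : ℕ) (j : ℕ)) hmul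
    simp only [add_mul, one_mul, entry_add, entry_one] at h2
    have h3 : entry (L (n + m) * Z) i j = ∑ k : Fin (n + m), entry K i k * entry Z k j := by
      rw [Fin.sum_univ_eq_sum_range (fun k => entry K i k * entry Z k j)]
      refine (entry_mul _ _ _ _).unique ?_
      have h4 := hasSum_sum_of_ne_finset_zero (L := .unconditional ℕ) (s := Finset.range (n + m))
        (f := fun k => entry (L (n + m)) i k * entry Z k j) fun k hk => by
          rw [hLe, if_neg fun h => hk (Finset.mem_range.mpr h.2), zero_mul]
      convert h4 using 1
      refine Finset.sum_congr rfl fun k hk => ?_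
      rw [hLe, if_pos ⟨i.2, Finset.mem_range.mp hk⟩]
    rw [h3] at h2
    rw [Matrix.add_mul, Matrix.one_mul, Matrix.add_apply, Matrix.mul_apply, Matrix.one_apply]
    simp only [Fin.ext_iff]
    exact h2
  have hblk : (1 + Matrix.of fun i j : Fin (n + m) => entry K i j).submatrix finSumFinEquiv
      finSumFinEquiv * (leading (n + m) Z).submatrix finSumFinEquiv finSumFinEquiv = 1 := by
    rw [Matrix.submatrix_mul_equiv, hfin, Matrix.submatrix_one_equiv]
  have h5 := det_mul_det_toBlocks₁₁ hblk
  rw [Matrix.det_submatrix_equiv_self] at h5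
  refine h5.trans (congrArg Matrix.det ?_)
  ext i j
  simp [Matrix.toBlocks₂₂, Matrix.one_apply]

/-- By Jacobi's identity, a zero determinant would annihilate every tail determinant, yet these tend
to 1. -/
theorem fredholmDet_ne_zero {K X : ell2 ℕ →L[ℂ] ell2 ℕ} {C r : ℝ} (hC : 0 ≤ C)
    (h0 : 0 < r) (h1 : r < 1) (hK : ∀ j k, ‖entry K j k‖ ≤ C * r ^ (j + k))
    (hYX : (1 + K) * X = 1) (hXY : X * (1 + K) = 1) : fredholmDet (1 + K) ≠ 0 := by
  intro h
  have hne := (tendsto_tsum_det_principal_shift hC h0 h1 hK).eventually_ne one_ne_zero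
  obtain ⟨n, hn⟩ := hne.exists
  rw [← fredholmDet_mul_det_leading_inverse hC h0 h1 hK hYX hXY, h, zero_mul] at hn
  exact hn rfl

/-- K is the sum of ⟨e_k, ·⟩ K e_k, and the norms of the columns K e_k are bounded by a geometric
sequence. -/
theorem isTraceClass_of_decay {K : ell2 ℕ →L[ℂ] ell2 ℕ} {C r : ℝ} (h0 : 0 < r)
    (h1 : r < 1) (hK : ∀ j k, ‖entry K j k‖ ≤ C * r ^ (j + k)) : IsTraceClass K := by
  have hg := summable_geometric_of_lt_one h0.le h1
  have he : ∀ k : ℕ, ‖(lp.single 2 k (1 : ℂ) : ell2 ℕ)‖ = 1 := fun k => by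
    rw [lp.norm_single (by norm_num)]; simp
  refine ⟨fun k => K (lp.single 2 k 1), fun k => lp.single 2 k 1, ?_, fun x => ?_⟩
  · refine Summable.of_nonneg_of_le (fun _ => by positivity) (fun k => ?_)
      (hg.mul_left (C * (1 - r)⁻¹))
    beta_reduce
    rw [he, mul_one, ← (ell2_hasSum_single (K (lp.single 2 k 1))).tsum_eq]
    refine (tsum_of_norm_bounded (hg.mul_left (C * r ^ k)).hasSum fun j => ?_).trans_eq ?_
    · rw [norm_smul, he, mul_one]
      exact (hK j k).trans_eq (by rw [pow_add]; ring)
    · rw [tsum_mul_left, tsum_geometric_of_lt_one h0.le h1]; ring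
  · have := K.hasSum (ell2_hasSum_single x)
    simpa [lp.inner_single_left] using this

theorem norm_entry_mul_le {A B : ell2 ℕ →L[ℂ] ell2 ℕ} {C C' r : ℝ} (h0 : 0 < r)
    (h1 : r < 1) (hC : 0 ≤ C) (hA : ∀ j k, ‖entry A j k‖ ≤ C * r ^ (j + k))
    (hB : ∀ j k, ‖entry B j k‖ ≤ C' * r ^ (j + k)) (j k : ℕ) :
    ‖entry (A * B) j k‖ ≤ C * C' * (1 - r)⁻¹ * r ^ (j + k) := by
  rw [← (entry_mul A B j k).tsum_eq]
  refine (tsum_of_norm_bounded ((summable_geometric_of_lt_one h0.le h1).mul_left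
    (C * r ^ j * (C' * r ^ k))).hasSum fun l => ?_).trans_eq ?_
  · rw [norm_mul]
    calc _ ≤ (C * r ^ (j + l)) * (C' * r ^ (l + k)) := by
          gcongr; exacts [hA _ _, hB _ _]
      _ = C * r ^ j * (C' * r ^ k) * r ^ l * r ^ l := by ring
      _ ≤ C * r ^ j * (C' * r ^ k) * r ^ l * 1 := by
          have : 0 ≤ C' := by simpa using (norm_nonneg _).trans (hB 0 0)
          gcongr
          exact pow_le_one₀ h0.le h1.le
      _ = _ := mul_one _
  · rw [tsum_mul_left, tsum_geometric_of_lt_one h0.le h1]; ring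

end

/-! ## Star-Toeplitz and star-Hankel operators of star products -/

/-- In the matrix product L(a)L(b) the intermediate indices l ≥ 1 give the Toeplitz product and l ≤
0 the Hankel product; the reflection l ↦ 1 - l matches the latter with H(b^∼). -/
theorem toeplitzOp_starMul {a b : SymbolFn} (ha : CoeffDecay a) (hb : CoeffDecay b) :
    toeplitzOp (starMul a b) =
      toeplitzOp a * toeplitzOp b + hankelOp a * hankelOp (reflect b) := by
  refine entry_ext fun i j => ?_
  rw [(ha.starMul hb).entry_toeplitzOp, ← (ha.starMul hb).entry_laurentOp, ha.laurentOp_starMul hb,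
    entry_add]
  have h := (Equiv.addRight (1 : ℤ)).hasSum_iff.mpr
    (entry_mul (laurentOp a) (laurentOp b) ((i : ℤ) + 1) ((j : ℤ) + 1))
  refine h.unique (HasSum.of_nat_of_neg_add_one ?_ ?_)
  · convert entry_mul (toeplitzOp a) (toeplitzOp b) i j using 2 with k
    rw [ha.entry_toeplitzOp, hb.entry_toeplitzOp]
    simp [ha.entry_laurentOp, hb.entry_laurentOp]
  · convert entry_mul (hankelOp a) (hankelOp (reflect b)) i j using 2 with k
    rw [ha.entry_hankelOp, hb.reflect.entry_hankelOp, laurentEntry_reflect]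
    simp [ha.entry_laurentOp, hb.entry_laurentOp, add_comm]

theorem CoeffDecay.isMinus_iff {a : SymbolFn} (ha : CoeffDecay a) :
    IsMinus a ↔ laurentOp a ∈ triangular (· ≤ ·) := by
  simp only [mem_triangular, ha.entry_laurentOp, not_le]; rfl

theorem CoeffDecay.isPlus_iff {a : SymbolFn} (ha : CoeffDecay a) :
    IsPlus a ↔ laurentOp a ∈ triangular (· ≥ ·) := by
  simp only [mem_triangular, ha.entry_laurentOp, ge_iff_le, not_le]; rfl

theorem toeplitzOp_starMul_of_isMinus {a b : SymbolFn} (ha : CoeffDecay a) (hb : CoeffDecay b)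
    (h : IsMinus a) : toeplitzOp (starMul a b) = toeplitzOp a * toeplitzOp b := by
  have : hankelOp a = 0 := entry_ext fun i j => by
    rw [ha.entry_hankelOp, h _ _ (by omega)]; rfl
  rw [toeplitzOp_starMul ha hb, this, zero_mul, add_zero]

theorem toeplitzOp_starMul_of_isPlus {a b : SymbolFn} (ha : CoeffDecay a) (hb : CoeffDecay b)
    (h : IsPlus b) : toeplitzOp (starMul a b) = toeplitzOp a * toeplitzOp b := by
  have : hankelOp (reflect b) = 0 := entry_ext fun i j => by
    rw [hb.reflect.entry_hankelOp, laurentEntry_reflect, h _ _ (by omega)]; rfl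
  rw [toeplitzOp_starMul ha hb, this, mul_zero, add_zero]

theorem toeplitzOp_starMul_eq_one {a b : SymbolFn} (ha : CoeffDecay a) (hb : CoeffDecay b)
    (h : laurentOp a * laurentOp b = 1) : toeplitzOp (starMul a b) = 1 := entry_ext fun i j => by
  rw [(ha.starMul hb).entry_toeplitzOp, ← (ha.starMul hb).entry_laurentOp, ha.laurentOp_starMul hb,
    h, entry_one, entry_one]
  simp

theorem norm_entry_hankelOp_le {a : SymbolFn} {C r : ℝ} (hC : 0 ≤ C) (h0 : 0 < r) (h1 : r < 1)
    (h : ∀ N k, ‖coeff (a N) k‖ ≤ C * r ^ k.natAbs) (j k : ℕ) :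
    ‖entry (hankelOp a) j k‖ ≤ C * r ^ (j + k) := by
  have ha : CoeffDecay a := ⟨C, r, hC, h0, h1, h⟩
  rw [ha.entry_hankelOp]
  refine (h _ _).trans ?_
  gcongr ?_ * ?_
  exact pow_le_pow_of_le_one h0.le h1.le (by omega)

theorem exists_bound_hankelOp_mul {a b : SymbolFn} (ha : CoeffDecay a) (hb : CoeffDecay b) :
    ∃ C r : ℝ, 0 ≤ C ∧ 0 < r ∧ r < 1 ∧
      ∀ j k, ‖entry (hankelOp a * hankelOp b) j k‖ ≤ C * r ^ (j + k) := by
  obtain ⟨C, r, hC, h0, h1, h, h'⟩ := ha.common hb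
  exact ⟨_, r, mul_nonneg (mul_nonneg hC hC) (inv_nonneg.mpr (by linarith)), h0, h1,
    norm_entry_mul_le h0 h1 hC (norm_entry_hankelOp_le hC h0 h1 h)
      (norm_entry_hankelOp_le hC h0 h1 h')⟩

/-- L(z^{-n}) is a shift, so left multiplication by it moves the rows by n. -/
theorem entry_hankelOp_zpow_starMul {a : SymbolFn} (ha : CoeffDecay a) (n i j : ℕ) :
    entry (hankelOp (starMul (zpowSymbol (-(n : ℤ))) a)) i j = entry (hankelOp a) (n + i) j := by
  have hz := coeffDecay_zpowSymbol (-(n : ℤ))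
  rw [(hz.starMul ha).entry_hankelOp, laurentEntry_starMul hz ha, ha.entry_hankelOp,
    tsum_eq_single ((i : ℤ) + 1 + n) fun l hl => ?_]
  · rw [laurentEntry_zpowSymbol, if_pos (by ring), one_mul]
    push_cast
    ring_nf
  · rw [laurentEntry_zpowSymbol, if_neg (by omega), zero_mul]

theorem entry_hankelOp_starMul_zpow {a : SymbolFn} (ha : CoeffDecay a) (n i j : ℕ) :
    entry (hankelOp (starMul a (zpowSymbol (-(n : ℤ))))) i j = entry (hankelOp a) i (n + j) := by
  have hz := coeffDecay_zpowSymbol (-(n : ℤ))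
  rw [(ha.starMul hz).entry_hankelOp, laurentEntry_starMul ha hz, ha.entry_hankelOp,
    tsum_eq_single (-(j : ℤ) - n) fun l hl => ?_]
  · rw [laurentEntry_zpowSymbol, if_pos (by ring), mul_one]
    push_cast
    ring_nf
  · rw [laurentEntry_zpowSymbol, if_neg (by omega), mul_zero]

/-! ## Leading blocks of triangular operators -/

theorem leading_mul_of_left {n : ℕ} {A : ell2 ℕ →L[ℂ] ell2 ℕ} (B : ell2 ℕ →L[ℂ] ell2 ℕ)
    (h : ∀ i k, i < k → entry A i k = 0) : leading n (A * B) = leading n A * leading n B := by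
  ext i j
  rw [Matrix.mul_apply]
  refine (entry_mul A B i j).unique ?_
  have h4 := hasSum_sum_of_ne_finset_zero (L := .unconditional ℕ) (s := Finset.range n)
    (f := fun k => entry A i k * entry B k j) fun k hk => by
      rw [h _ _ (i.2.trans_le (by simpa using hk)), zero_mul]
  rwa [← Fin.sum_univ_eq_sum_range (fun k => entry A i k * entry B k j)] at h4

theorem leading_mul_of_right {n : ℕ} (A : ell2 ℕ →L[ℂ] ell2 ℕ) {B : ell2 ℕ →L[ℂ] ell2 ℕ}
    (h : ∀ k j, j < k → entry B k j = 0) : leading n (A * B) = leading n A * leading n B := by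
  ext i j
  rw [Matrix.mul_apply]
  refine (entry_mul A B i j).unique ?_
  have h4 := hasSum_sum_of_ne_finset_zero (L := .unconditional ℕ) (s := Finset.range n)
    (f := fun k => entry A i k * entry B k j) fun k hk => by
      rw [h _ _ (j.2.trans_le (by simpa using hk)), mul_zero]
  rwa [← Fin.sum_univ_eq_sum_range (fun k => entry A i k * entry B k j)] at h4

theorem IsPlus.entry_toeplitzOp {a : SymbolFn} (h : IsPlus a) (ha : CoeffDecay a) (i k : ℕ)
    (hik : i < k) : entry (toeplitzOp a) i k = 0 := by
  rw [ha.entry_toeplitzOp, h _ _ (by omega)]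

theorem IsMinus.entry_toeplitzOp {a : SymbolFn} (h : IsMinus a) (ha : CoeffDecay a) (i k : ℕ)
    (hik : k < i) : entry (toeplitzOp a) i k = 0 := by
  rw [ha.entry_toeplitzOp, h _ _ (by omega)]

theorem prod_diagonal (a : SymbolFn) (ha : CoeffDecay a) (n : ℕ) :
    ∏ i : Fin n, leading n (toeplitzOp a) i i =
      ∏ j ∈ Finset.Icc 1 n, coeff (a (2 * (j : ℤ))) 0 := by
  have h : ∀ i : Fin n, leading n (toeplitzOp a) i i = coeff (a (2 * (((i : ℕ) + 1 : ℕ) : ℤ))) 0 :=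
    fun i => by
      change entry (toeplitzOp a) i i = _
      rw [ha.entry_toeplitzOp, laurentEntry, sub_self]
      congr 2
      push_cast
      ring
  simp only [h]
  rw [Fin.prod_univ_eq_prod_range (fun i => coeff (a (2 * ((i + 1 : ℕ) : ℤ))) 0),
    Finset.range_eq_Ico, Finset.prod_Ico_add' (fun i : ℕ => coeff (a (2 * (i : ℤ))) 0)]
  rfl

theorem det_leading_of_isPlus {a : SymbolFn} (h : IsPlus a) (ha : CoeffDecay a) (n : ℕ) :
    (leading n (toeplitzOp a)).det = ∏ j ∈ Finset.Icc 1 n, coeff (a (2 * (j : ℤ))) 0 := by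
  rw [← prod_diagonal a ha]
  exact Matrix.det_of_isLowerTriangular _ fun i j hij => h.entry_toeplitzOp ha _ _ hij

theorem det_leading_of_isMinus {a : SymbolFn} (h : IsMinus a) (ha : CoeffDecay a) (n : ℕ) :
    (leading n (toeplitzOp a)).det = ∏ j ∈ Finset.Icc 1 n, coeff (a (2 * (j : ℤ))) 0 := by
  rw [← prod_diagonal a ha]
  exact Matrix.det_of_isUpperTriangular fun i j hij => h.entry_toeplitzOp ha _ _ hij

/-- The diagonal elements of a triangular operator with a triangular inverse do not vanish. -/
theorem entry_self_ne_zero {R : ℤ → ℤ → Prop} [IsPartialOrder ℤ R] {A B : ell2 ℤ →L[ℂ] ell2 ℤ}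
    (hA : A ∈ triangular R) (hB : B ∈ triangular R) (h : A * B = 1) (j : ℤ) : entry A j j ≠ 0 := by
  intro h0
  -- By antisymmetry of R only the intermediate index l = j could contribute.
  have h1 : entry (A * B) j j = 0 := by
    refine (entry_mul A B j j).unique ?_
    convert hasSum_zero (α := ℂ) (β := ℤ) with l
    by_cases hjl : R j l
    · by_cases hlj : R l j
      · rw [antisymm_of R hlj hjl, h0, zero_mul]
      · rw [hB _ _ hlj, mul_zero]
    · rw [hA _ _ hjl, zero_mul]
  rw [h, entry_one, if_pos rfl] at h1
  exact one_ne_zero h1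

theorem coeff_zero_ne_zero {R : ℤ → ℤ → Prop} [IsPartialOrder ℤ R] {a b : SymbolFn}
    (ha : CoeffDecay a) (hA : laurentOp a ∈ triangular R) (hB : laurentOp b ∈ triangular R)
    (h : laurentOp a * laurentOp b = 1) (j : ℤ) : coeff (a (2 * j)) 0 ≠ 0 := by
  have := entry_self_ne_zero hA hB h j
  rwa [ha.entry_laurentOp, laurentEntry, sub_self, ← two_mul] at this

end StarToeplitz

/-! ### The determinant identity -/

open StarToeplitz in
theorem proposition1 (a apL amL amR apR : SymbolFn) (ha : MemV a)
    (h : IsWienerHopf a apL amL amR apR) :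
    -- the two star inverses in the formula exist in `V`
    StarInvertible apR ∧ StarInvertible amR ∧
    -- the product of star-Toeplitz operators is invertible and has a nonzero determinant
    IsUnit (toeplitzOp (starMul amL (starInv apR)) * toeplitzOp (starMul (starInv amR) apL)) ∧
    IsTraceClass
      (toeplitzOp (starMul amL (starInv apR)) * toeplitzOp (starMul (starInv amR) apL) - 1) ∧
    fredholmDet (toeplitzOp (starMul amL (starInv apR)) * toeplitzOp (starMul (starInv amR) apL)) ≠ 0 ∧
    -- the identity, for every size `n`
    ∀ n : ℕ,
      IsTraceClass
        (hankelOp (starMul (zpowSymbol (-(n : ℤ))) (starMul amL (starInv apR))) *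
          hankelOp (starMul (reflect (starMul (starInv amR) apL)) (zpowSymbol (-(n : ℤ))))) ∧
      (∀ j ∈ Finset.Icc 1 n, coeff (apL (2 * (j : ℤ))) 0 * coeff (amL (2 * (j : ℤ))) 0 ≠ 0) ∧
      (toeplitzMatrix n a).det =
        fredholmDet
          (1 - hankelOp (starMul (zpowSymbol (-(n : ℤ))) (starMul amL (starInv apR))) *
            hankelOp (starMul (reflect (starMul (starInv amR) apL)) (zpowSymbol (-(n : ℤ))))) /
        fredholmDet
          (toeplitzOp (starMul amL (starInv apR)) * toeplitzOp (starMul (starInv amR) apL)) *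
        Complex.exp (∑ j ∈ Finset.Icc 1 n,
          Complex.log (coeff (apL (2 * (j : ℤ))) 0 * coeff (amL (2 * (j : ℤ))) 0)) := by
  have dpL := h.memV_apL.coeffDecay
  have dmL := h.memV_amL.coeffDecay
  have dmR := h.memV_amR.coeffDecay
  have dpR := h.memV_apR.coeffDecay
  have tpL := dpL.isPlus_iff.mp h.plus_apL
  have tmL := dmL.isMinus_iff.mp h.minus_amL
  obtain ⟨-, dpL', tpL', epL, epL'⟩ := h.log_apL.starInv h.memV_apL tpL
  obtain ⟨-, dmL', tmL', emL, emL'⟩ := h.log_amL.starInv h.memV_amL tmL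
  obtain ⟨imR, dmR', tmR', emR, emR'⟩ :=
    h.log_amR.starInv h.memV_amR (dmR.isMinus_iff.mp h.minus_amR)
  obtain ⟨ipR, dpR', tpR', epR, epR'⟩ :=
    h.log_apR.starInv h.memV_apR (dpR.isPlus_iff.mp h.plus_apR)
  -- the four star-Toeplitz factors are units
  have unitPlus : ∀ {b c : SymbolFn}, CoeffDecay b → CoeffDecay c → IsPlus b → IsPlus c →
      laurentOp b * laurentOp c = 1 → laurentOp c * laurentOp b = 1 →
      ∃ u : (ell2 ℕ →L[ℂ] ell2 ℕ)ˣ, (u : ell2 ℕ →L[ℂ] ell2 ℕ) = toeplitzOp b ∧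
        ((u⁻¹ : (ell2 ℕ →L[ℂ] ell2 ℕ)ˣ) : ell2 ℕ →L[ℂ] ell2 ℕ) = toeplitzOp c :=
    fun db dc pb pc e e' => ⟨⟨_, _,
      (toeplitzOp_starMul_of_isPlus db dc pc).symm.trans (toeplitzOp_starMul_eq_one db dc e),
      (toeplitzOp_starMul_of_isPlus dc db pb).symm.trans (toeplitzOp_starMul_eq_one dc db e')⟩,
      rfl, rfl⟩
  have unitMinus : ∀ {b c : SymbolFn}, CoeffDecay b → CoeffDecay c → IsMinus b → IsMinus c →
      laurentOp b * laurentOp c = 1 → laurentOp c * laurentOp b = 1 →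
      ∃ u : (ell2 ℕ →L[ℂ] ell2 ℕ)ˣ, (u : ell2 ℕ →L[ℂ] ell2 ℕ) = toeplitzOp b ∧
        ((u⁻¹ : (ell2 ℕ →L[ℂ] ell2 ℕ)ˣ) : ell2 ℕ →L[ℂ] ell2 ℕ) = toeplitzOp c :=
    fun db dc mb mc e e' => ⟨⟨_, _,
      (toeplitzOp_starMul_of_isMinus db dc mb).symm.trans (toeplitzOp_starMul_eq_one db dc e),
      (toeplitzOp_starMul_of_isMinus dc db mc).symm.trans (toeplitzOp_starMul_eq_one dc db e')⟩,
      rfl, rfl⟩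
  obtain ⟨upL, hupL, -⟩ := unitPlus dpL dpL' h.plus_apL (dpL'.isPlus_iff.mpr tpL') epL epL'
  obtain ⟨umL, humL, -⟩ := unitMinus dmL dmL' h.minus_amL (dmL'.isMinus_iff.mpr tmL') emL emL'
  obtain ⟨umR, humR, humR'⟩ := unitMinus dmR dmR' h.minus_amR (dmR'.isMinus_iff.mpr tmR') emR emR'
  obtain ⟨upR, hupR, hupR'⟩ := unitPlus dpR dpR' h.plus_apR (dpR'.isPlus_iff.mpr tpR') epR epR'
  -- the two symbols of the formula are star inverse to each other
  have dφ := dmL.starMul dpR'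
  have dψ := dmR'.starMul dpL
  have hLR : laurentOp apL * laurentOp amL = laurentOp amR * laurentOp apR := by
    rw [← dpL.laurentOp_starMul dmL, ← dmR.laurentOp_starMul dpR]
    exact entry_ext fun j k => by
      rw [(dpL.starMul dmL).entry_laurentOp, (dmR.starMul dpR).entry_laurentOp, ← h.left_eq j k,
        h.right_eq j k]
  have hφψ : laurentOp (starMul amL (starInv apR)) * laurentOp (starMul (starInv amR) apL) = 1 := by
    rw [dmL.laurentOp_starMul dpR', dmR'.laurentOp_starMul dpL]
    -- Both sides are inverses of L(a), one from each factorization.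
    have h1 : laurentOp (starInv apR) * laurentOp (starInv amR) =
        laurentOp (starInv amL) * laurentOp (starInv apL) := by
      refine left_inv_eq_right_inv (a := laurentOp amR * laurentOp apR) ?_ ?_
      · rw [mul_assoc, ← mul_assoc _ (laurentOp amR), emR', one_mul, epR']
      · rw [← hLR, mul_assoc, ← mul_assoc _ (laurentOp (starInv amL)), emL, one_mul, epL]
    rw [mul_assoc, ← mul_assoc (laurentOp (starInv apR)), h1, mul_assoc, epL', mul_one, emL]
  set φ := starMul amL (starInv apR)
  set ψ := starMul (starInv amR) apL
  have hTφ : toeplitzOp φ = (umL * upR⁻¹ : (ell2 ℕ →L[ℂ] ell2 ℕ)ˣ) := by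
    rw [Units.val_mul, humL, hupR']
    exact toeplitzOp_starMul_of_isMinus dmL dpR' h.minus_amL
  have hTψ : toeplitzOp ψ = (umR⁻¹ * upL : (ell2 ℕ →L[ℂ] ell2 ℕ)ˣ) := by
    rw [Units.val_mul, hupL, humR']
    exact toeplitzOp_starMul_of_isPlus dmR' dpL h.plus_apL
  let uY : (ell2 ℕ →L[ℂ] ell2 ℕ)ˣ := umL * upR⁻¹ * (umR⁻¹ * upL)
  let K : ell2 ℕ →L[ℂ] ell2 ℕ := -(hankelOp φ * hankelOp (reflect ψ))
  have hY : toeplitzOp φ * toeplitzOp ψ = uY := by rw [hTφ, hTψ]; rfl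
  have hYK : toeplitzOp φ * toeplitzOp ψ = 1 + K := by
    rw [← toeplitzOp_starMul_eq_one dφ dψ hφψ, toeplitzOp_starMul dφ dψ]
    simp [K]
  obtain ⟨C, r, hC, h0, h1, hb⟩ := exists_bound_hankelOp_mul dφ dψ.reflect
  have hKb : ∀ j k, ‖entry K j k‖ ≤ C * r ^ (j + k) := fun j k => by
    rw [entry_neg, norm_neg]; exact hb j k
  have hYX : (1 + K) * (uY⁻¹ : (ell2 ℕ →L[ℂ] ell2 ℕ)ˣ) = 1 := by
    rw [← hYK, hY]; exact uY.mul_inv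
  have hXY : (uY⁻¹ : (ell2 ℕ →L[ℂ] ell2 ℕ)ˣ) * (1 + K) = 1 := by
    rw [← hYK, hY]; exact uY.inv_mul
  have hne := fredholmDet_ne_zero hC h0 h1 hKb hYX hXY
  refine ⟨ipR, imR, ⟨uY, hY.symm⟩, ?_, ?_, fun n => ?_⟩
  · rw [hYK, add_sub_cancel_left]
    exact isTraceClass_of_decay h0 h1 hKb
  · rwa [hYK]
  have hshift : ∀ j k, entry (hankelOp (starMul (zpowSymbol (-(n : ℤ))) φ) *
      hankelOp (starMul (reflect ψ) (zpowSymbol (-(n : ℤ))))) j k =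
      entry (hankelOp φ * hankelOp (reflect ψ)) (n + j) (n + k) := fun j k => by
    refine (entry_mul _ _ j k).unique ?_
    simp only [entry_hankelOp_zpow_starMul dφ, entry_hankelOp_starMul_zpow dψ.reflect]
    exact entry_mul _ _ _ _
  have hdiag : ∀ j ∈ Finset.Icc 1 n,
      coeff (apL (2 * (j : ℤ))) 0 * coeff (amL (2 * (j : ℤ))) 0 ≠ 0 := fun j _ =>
    mul_ne_zero (coeff_zero_ne_zero dpL tpL tpL' epL j) (coeff_zero_ne_zero dmL tmL tmL' emL j)
  refine ⟨isTraceClass_of_decay (C := C) h0 h1 fun j k => ?_, hdiag, ?_⟩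
  · rw [hshift]
    refine (hb _ _).trans ?_
    gcongr ?_ * ?_
    exact pow_le_pow_of_le_one h0.le h1.le (by omega)
  have hjac := fredholmDet_mul_det_leading_inverse hC h0 h1 hKb hYX hXY n
  have hnum : fredholmDet (1 - hankelOp (starMul (zpowSymbol (-(n : ℤ))) φ) *
      hankelOp (starMul (reflect ψ) (zpowSymbol (-(n : ℤ))))) =
      ∑' S, (principal (fun j k => entry K (n + j) (n + k)) S).det := by
    rw [sub_eq_add_neg, fredholmDet_one_add]
    congr! 4 with S
    ext j k
    rw [entry_neg, hshift, entry_neg]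
  have hT : leading n (toeplitzOp (starMul amR apR)) = toeplitzMatrix n a := by
    ext i j
    change entry _ _ _ = laurentEntry a _ _
    rw [(dmR.starMul dpR).entry_toeplitzOp, h.right_eq]
  -- Y⁻¹ = T(a_+^L)⁻¹ T(a_-^R) T(a_+^R) T(a_-^L)⁻¹, and its two middle factors form T(a).
  have hfac : toeplitzOp (starMul amR apR) =
      toeplitzOp apL * ((uY⁻¹ : (ell2 ℕ →L[ℂ] ell2 ℕ)ˣ) * toeplitzOp amL) := by
    rw [toeplitzOp_starMul_of_isMinus dmR dpR h.minus_amR, ← humR, ← hupR, ← hupL, ← humL]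
    simp only [← Units.val_mul]
    congr 1
    simp only [uY]
    group
  have hdet : (toeplitzMatrix n a).det = (∏ j ∈ Finset.Icc 1 n, coeff (apL (2 * (j : ℤ))) 0) *
      ((leading n (uY⁻¹ : (ell2 ℕ →L[ℂ] ell2 ℕ)ˣ)).det *
        ∏ j ∈ Finset.Icc 1 n, coeff (amL (2 * (j : ℤ))) 0) := by
    rw [← hT, hfac, leading_mul_of_left _ (h.plus_apL.entry_toeplitzOp dpL),
      leading_mul_of_right _ (h.minus_amL.entry_toeplitzOp dmL), Matrix.det_mul, Matrix.det_mul,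
      det_leading_of_isPlus h.plus_apL dpL, det_leading_of_isMinus h.minus_amL dmL]
  -- Only exp (log w) = w for w ≠ 0 enters, so the branch of the logarithm is immaterial.
  rw [hnum, hYK, ← hjac, mul_div_cancel_left₀ _ hne, Complex.exp_sum,
    Finset.prod_congr rfl fun j hj => Complex.exp_log (hdiag j hj), Finset.prod_mul_distrib, hdet]
  ring
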